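/- Let $m = m_n \ge n$ be any sequence of positive integers, and for each $n \ge 1$ let $A$ be a random real $m \times n$ matrix whose entries are independent standard Cauchy random variables, with density $\frac{1}{\pi(1+x^2)}$. Let $\lambda_1 \ge \dots \ge \lambda_n \ge 0$ be the eigenvalues of $A^{t}A$, and put $\tilde\lambda_i = \lambda_i/(n^2m^2)$. Let $z \in \mathbb{C}$ with $\operatorname{Re} z > 0$. Then $$\lim_{n\to\infty} E\left[\prod_{i=1}^n (1+z\tilde\lambda_i)^{-1/2} \sum_{j=1}^n \frac{\tilde\lambda_j}{1+z\tilde\lambda_j}\right] = \frac{2}{\pi}\, z^{-1/2} \exp\left(-\frac{2}{\pi}\sqrt z\right) = \mathbf{E}\left[\prod_{i=1}^\infty (1+z x_i)^{-1/2} \sum_{j=1}^\infty \frac{x_j}{1+z x_j}\right],$$ where all roots are the principal branches on the right half-plane $\{\operatorname{Re} w > 0\}$ (so $\sqrt 1 = 1$), and $\mathbf{E}$ is the expectation with respect to the Poisson point process $\{x_1, x_2, \dots\}$ on $(0,\infty)$ with intensity $\rho(x) = \frac{1}{\pi x^{3/2}}$, i.e. the random point process whose numbers of points in disjoint intervals are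 independent, the number of points in an interval $I$ with $\int_I \rho(x)\,dx<\infty$ being a Poisson random variable with parameter $\int_I \rho(x)\,dx$. In particular, the random variables inside both expectations are integrable, and the infinite product and the infinite series converge almost surely. -/

import Mathlib

open MeasureTheory ProbabilityTheory Filter Topology
open scoped Matrix

/-- `A` is a random real `m × n` matrix whose entries are independent standard Cauchy random
variables (density `1 / (π (1 + x ^ 2))`) on the probability space `(Ω, P)`. -/
structure IsCauchyMatrix {Ω : Type*} [MeasurableSpace Ω] {m n : ℕ} (P : Measure Ω)
    (A : Ω → Matrix (Fin m) (Fin n) ℝ) : Prop where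
  entry_law : ∀ j k, HasLaw (fun ω => A ω j k) (cauchyMeasure 0 1) P
  indep : iIndepFun (fun (p : Fin m × Fin n) ω => A ω p.1 p.2) P

theorem isHermitian_transpose_mul_self_real {m n : ℕ} (A : Matrix (Fin m) (Fin n) ℝ) :
    (Aᵀ * A).IsHermitian := by
  have h := Matrix.isHermitian_conjTranspose_mul_self A
  rwa [Matrix.conjTranspose_eq_transpose_of_trivial] at h

/-- The rescaled eigenvalues `λ_i / (n ^ 2 m ^ 2)` of `Aᵀ A`, listed with multiplicity. -/
noncomputable def rescaledEigenvalue {m n : ℕ} (A : Matrix (Fin m) (Fin n) ℝ) (i : Fin n) : ℝ :=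
  (isHermitian_transpose_mul_self_real A).eigenvalues i / ((n : ℝ) ^ 2 * (m : ℝ) ^ 2)

/-- The number of indices `i` (possibly infinite) such that the point `X i ω` lies in `I`. -/
noncomputable def pointCount {Ω : Type*} (X : ℕ → Ω → ℝ) (I : Set ℝ) (ω : Ω) : ℕ∞ :=
  {i : ℕ | X i ω ∈ I}.encard

/-- The random points `X 0, X 1, X 2, …` of `(0, ∞)`, in any measurable enumeration, form a Poisson
point process with intensity `ρ` on the positive half-axis: the number of points in an interval `I`
with `∫ x in I, ρ x < ∞` is Poisson with this integral as parameter, and the numbers of points in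
disjoint intervals are independent. (Since there are infinitely many points, this is meant for
intensities of infinite total mass.) -/
structure IsPoissonPointProcess {Ω : Type*} [MeasurableSpace Ω] (P : Measure Ω) (ρ : ℝ → ℝ)
    (X : ℕ → Ω → ℝ) : Prop where
  measurable : ∀ i, Measurable (X i)
  pos : ∀ i ω, 0 < X i ω
  count_law : ∀ I : Set ℝ, I.OrdConnected → I ⊆ Set.Ioi 0 → IntegrableOn ρ I →
    HasLaw (pointCount X I)
      ((poissonMeasure (∫ x in I, ρ x).toNNReal).map (Nat.cast : ℕ → ℕ∞)) P
  count_indep : ∀ (k : ℕ) (I : Fin k → Set ℝ), (∀ j, (I j).OrdConnected) →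
    (∀ j, I j ⊆ Set.Ioi 0) → Pairwise (fun i j => Disjoint (I i) (I j)) →
    iIndepFun (fun j => pointCount X (I j)) P

/-- The intensity `1 / (π x ^ (3 / 2))`, used for `x > 0`. -/
noncomputable def cauchyIntensity (x : ℝ) : ℝ := 1 / (Real.pi * x ^ (3 / 2 : ℝ))

/-! ### Bounded holomorphic functions on the right half-plane -/

/-! For summable nonnegative `x_i`, put `D(z) = ∏ (1 + z x_i)^(-1/2)`. On the right half-plane `D`
is holomorphic and bounded by 1, and both random variables in the theorem have the form `-2 D'(z)`
(`deriv_invSqrtDet`). Cauchy's estimate moves the derivative outside the expectation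
(`hasDerivAt_integral_of_bounded_holomorphic`), and Cauchy's formula carries pointwise limits of
bounded holomorphic functions over to their derivatives (`tendsto_deriv_of_bounded_rightHalfPlane`).
It therefore suffices to prove `E D(z) → exp(-(2/π)√z)` for the matrices and equality for the
Poisson process; differentiating gives the stated value.

Matrix side. Diagonalising `AᵗA` writes `D(z)` as the average of `exp(-z |Ag|² / (2n²m²))` over a
standard Gaussian vector `g` (`integral_quadExp_gaussian`). After exchanging the two averages, `g`
is fixed, and the `m` coordinates of `Ag` are independent Cauchy variables of scale `‖g‖₁`
(`map_sum_mul_pi_cauchyMeasure`). With `φ(w) = E exp(-w C²)`, `C` standard Cauchy, this leaves the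
average of `φ(ζ/m²)^m`, where `ζ = z (‖g‖₁/n)² / 2`. The heavy tail of `C` gives `m (φ(ζ/m²) - 1) →
-2√(ζ/π)`, and the law of large numbers gives `‖g‖₁/n → √(2/π)`, so `ζ → z/π` and the limit is
`exp(-(2/π)√z)`.

Poisson side. The Laplace functional gives `E ∏ f(x_i) = exp ∫ (f - 1) ρ`. It is derived from the
interval counts by rounding the points down to a grid and refining it
(`IsPoissonPointProcess.integral_invSqrtDet`). For `f(x) = (1 + z x)^(-1/2)` the exponent is
elementary (`integral_invSqrtOneAdd`). -/

theorem isOpen_rightHalfPlane : IsOpen {z : ℂ | 0 < z.re} :=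
  isOpen_lt continuous_const Complex.continuous_re

theorem closedBall_subset_rightHalfPlane {z w : ℂ} (hw : w ∈ Metric.closedBall z (z.re / 2))
    (hz : 0 < z.re) : 0 < w.re := by
  have h1 : |(w - z).re| ≤ z.re / 2 :=
    (Complex.abs_re_le_norm _).trans (by simpa [dist_eq_norm] using hw)
  rw [Complex.sub_re] at h1
  linarith [(abs_le.mp h1).1]

/-- Cauchy's estimate on the circle of radius `Re z / 2`, which stays inside the half-plane. -/
theorem norm_deriv_le_of_bounded_rightHalfPlane {f : ℂ → ℂ}
    (hf : DifferentiableOn ℂ f {z | 0 < z.re}) (hb : ∀ z : ℂ, 0 < z.re → ‖f z‖ ≤ 1)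
    {z : ℂ} (hz : 0 < z.re) : ‖deriv f z‖ ≤ 2 / z.re := by
  have h := Complex.norm_deriv_le_of_forall_mem_sphere_norm_le (c := z) (R := z.re / 2) (C := 1)
    (f := f) (by positivity)
    (hf.diffContOnCl_ball fun w hw => closedBall_subset_rightHalfPlane hw hz)
    (fun w hw => hb w (closedBall_subset_rightHalfPlane (Metric.sphere_subset_closedBall hw) hz))
  rwa [one_div_div] at h

/-- Differentiation under the expectation for random bounded holomorphic functions. -/
theorem hasDerivAt_integral_of_bounded_holomorphic {Ω : Type*} [MeasurableSpace Ω] {P : Measure Ω}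
    [IsProbabilityMeasure P] {F : ℂ → Ω → ℂ}
    (hm : ∀ z : ℂ, 0 < z.re → AEStronglyMeasurable (F z) P)
    (hd : ∀ᵐ ω ∂P, DifferentiableOn ℂ (fun z => F z ω) {z | 0 < z.re})
    (hb : ∀ᵐ ω ∂P, ∀ z : ℂ, 0 < z.re → ‖F z ω‖ ≤ 1) {z : ℂ} (hz : 0 < z.re) :
    Integrable (fun ω => deriv (fun w => F w ω) z) P ∧
      HasDerivAt (fun w => ∫ ω, F w ω ∂P) (∫ ω, deriv (fun w => F w ω) z ∂P) z := by
  have hS : Metric.ball z (z.re / 2) ∈ 𝓝 z := Metric.ball_mem_nhds _ (by positivity)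
  have hsub : ∀ w ∈ Metric.ball z (z.re / 2), z.re / 2 < w.re := fun w hw => by
    have h1 : |(w - z).re| < z.re / 2 :=
      (Complex.abs_re_le_norm _).trans_lt (by simpa [dist_eq_norm] using hw)
    rw [Complex.sub_re] at h1
    linarith [(abs_lt.mp h1).1]
  have hpos : ∀ w ∈ Metric.ball z (z.re / 2), 0 < w.re := fun w hw => by
    linarith [hsub w hw]
  have hDA : ∀ᵐ ω ∂P, ∀ w : ℂ, 0 < w.re → HasDerivAt (fun w => F w ω) (deriv (fun w => F w ω) w) w := by
    filter_upwards [hd] with ω hω w hw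
    exact (hω.differentiableAt (isOpen_rightHalfPlane.mem_nhds hw)).hasDerivAt
  -- On the ball `Re w > Re z / 2`, so Cauchy's estimate `2 / Re w` is at most `4 / Re z`.
  refine hasDerivAt_integral_of_dominated_loc_of_deriv_le (F := F) (bound := fun _ => 4 / z.re)
    (F' := fun w ω => deriv (fun w => F w ω) w) hS ?_ ?_ ?_ ?_ (integrable_const _) ?_
  · filter_upwards [hS] with w hw using hm w (hpos w hw)
  · refine Integrable.of_bound (hm z hz) 1 ?_
    filter_upwards [hb] with ω hω using hω z hz
  -- The derivative is measurable in `ω` as an almost sure limit of difference quotients along `z +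
  -- 1/(k+1)`.
  · let u : ℕ → ℂ := fun k => z + (((k : ℝ) + 1)⁻¹ : ℝ)
    have hu0 : ∀ k, u k ≠ z := fun k => by
      have : ((k : ℝ) + 1)⁻¹ ≠ 0 := by positivity
      simpa [u] using Complex.ofReal_ne_zero.mpr this
    have hut : Tendsto u atTop (𝓝[≠] z) := by
      refine tendsto_nhdsWithin_iff.mpr ⟨?_, Eventually.of_forall hu0⟩
      have h1 : Tendsto (fun k : ℕ => ((k : ℝ) + 1)⁻¹) atTop (𝓝 0) := by
        simpa using tendsto_one_div_add_atTop_nhds_zero_nat (𝕜 := ℝ)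
      have h2 := (Complex.continuous_ofReal.tendsto 0).comp h1
      simpa [u, Function.comp_def] using h2.const_add z
    have hure : ∀ k, 0 < (u k).re := fun k => by
      have : 0 < ((k : ℝ) + 1)⁻¹ := by positivity
      simp only [u, Complex.add_re, Complex.ofReal_re]
      linarith
    refine aestronglyMeasurable_of_tendsto_ae atTop
      (f := fun k ω => slope (fun w => F w ω) z (u k)) (fun k => ?_) ?_
    · simp only [slope_def_field, div_eq_mul_inv]
      exact AEStronglyMeasurable.mul_const ((hm _ (hure k)).sub (hm z hz)) _
    · filter_upwards [hDA] with ω hω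
      exact (hasDerivAt_iff_tendsto_slope.mp (hω z hz)).comp hut
  · filter_upwards [hd, hb] with ω hω hω' w hw
    refine (norm_deriv_le_of_bounded_rightHalfPlane hω hω' (hpos w hw)).trans ?_
    rw [div_le_div_iff₀ (hpos w hw) hz]
    linarith [hsub w hw]
  · filter_upwards [hDA] with ω hω w hw using hω w (hpos w hw)

/-- Derivatives of uniformly bounded holomorphic functions converge if the functions do. -/
theorem tendsto_deriv_of_bounded_rightHalfPlane {f : ℕ → ℂ → ℂ} {g : ℂ → ℂ}
    (hf : ∀ n, DifferentiableOn ℂ (f n) {z | 0 < z.re})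
    (hb : ∀ n, ∀ z : ℂ, 0 < z.re → ‖f n z‖ ≤ 1)
    (hg : DifferentiableOn ℂ g {z | 0 < z.re})
    (hlim : ∀ z : ℂ, 0 < z.re → Tendsto (fun n => f n z) atTop (𝓝 (g z))) {z : ℂ}
    (hz : 0 < z.re) : Tendsto (fun n => deriv (f n) z) atTop (𝓝 (deriv g z)) := by
  have hR : 0 < z.re / 2 := by positivity
  have hcl : ∀ w ∈ Metric.closedBall z (z.re / 2), 0 < w.re :=
    fun w hw => closedBall_subset_rightHalfPlane hw hz
  have hcirc : ∀ θ : ℝ, 0 < (circleMap z (z.re / 2) θ).re := fun θ =>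
    hcl _ (Metric.sphere_subset_closedBall (circleMap_mem_sphere z hR.le θ))
  have hne : ∀ θ : ℝ, circleMap z (z.re / 2) θ - z ≠ 0 := fun θ => by
    rw [sub_ne_zero]; exact circleMap_ne_center hR.ne'
  -- Cauchy's formula turns the derivative into a circle integral of the function itself, to which
  -- dominated convergence applies.
  have key : ∀ h : ℂ → ℂ, DifferentiableOn ℂ h {z | 0 < z.re} →
      deriv h z = (2 * (Real.pi : ℂ) * Complex.I)⁻¹ *
        ∮ w in C(z, z.re / 2), (1 / (w - z) ^ 2) • h w := by
    intro h hh
    rw [DiffContOnCl.deriv_eq_smul_circleIntegral hR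
      (hh.diffContOnCl_ball hcl), smul_eq_mul, ← mul_assoc,
      inv_mul_cancel₀ Complex.two_pi_I_ne_zero, one_mul]
  rw [key g hg]
  simp_rw [fun n => key (f n) (hf n)]
  refine Tendsto.const_mul _ ?_
  unfold circleIntegral
  have hc : ∀ h : ℂ → ℂ, DifferentiableOn ℂ h {z | 0 < z.re} →
      Continuous fun θ => deriv (circleMap z (z.re / 2)) θ •
        (1 / (circleMap z (z.re / 2) θ - z) ^ 2) • h (circleMap z (z.re / 2) θ) := by
    intro h hh
    have h1 : Continuous fun θ => h (circleMap z (z.re / 2) θ) :=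
      hh.continuousOn.comp_continuous (continuous_circleMap _ _) hcirc
    simp only [deriv_circleMap, smul_eq_mul]
    refine ((continuous_circleMap _ _).mul continuous_const).mul (Continuous.mul ?_ h1)
    exact continuous_const.div (((continuous_circleMap _ _).sub continuous_const).pow 2)
      (fun θ => pow_ne_zero 2 (hne θ))
  refine intervalIntegral.tendsto_integral_filter_of_dominated_convergence
    (fun _ => (z.re / 2) * (1 / (z.re / 2) ^ 2)) ?_ ?_ ?_ ?_
  · exact Eventually.of_forall fun n => (hc _ (hf n)).aestronglyMeasurable
  · refine Eventually.of_forall fun n => ae_of_all _ fun θ _ => ?_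
    have h2 : ‖deriv (circleMap z (z.re / 2)) θ‖ = z.re / 2 := by
      simp [deriv_circleMap, abs_of_pos hR]
    have h3 : ‖circleMap z (z.re / 2) θ - z‖ = z.re / 2 := by
      simp [circleMap, abs_of_pos hz]
    rw [norm_smul, norm_smul, h2, norm_div, norm_pow, h3, norm_one]
    refine mul_le_mul_of_nonneg_left ?_ hR.le
    exact mul_le_of_le_one_right (by positivity) (hb n _ (hcirc θ))
  · exact intervalIntegrable_const
  · refine ae_of_all _ fun θ _ => ?_
    exact ((hlim _ (hcirc θ)).const_smul _).const_smul _

/-! ### Inverse square roots of determinants `∏ (1 + z x_i)` -/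

/-- The exponential form of `∏ (1 + z x_i) ^ (-1/2)`. -/
noncomputable def invSqrtDet {ι : Type*} (x : ι → ℝ) (z : ℂ) : ℂ :=
  Complex.exp (-(1 / 2) * ∑' i, Complex.log (1 + z * (x i : ℂ)))

theorem one_le_norm_one_add {w : ℂ} (hw : 0 ≤ w.re) : 1 ≤ ‖1 + w‖ := by
  refine le_trans ?_ (Complex.re_le_norm _)
  simp [hw]

/-- Mean value inequality from 0: the derivative `1 / (1 + w)` has norm at most 1 on the convex set
`Re w ≥ 0`. -/
theorem norm_log_one_add_le_norm {w : ℂ} (hw : 0 ≤ w.re) : ‖Complex.log (1 + w)‖ ≤ ‖w‖ := by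
  have h := Convex.norm_image_sub_le_of_norm_hasDerivWithin_le (𝕜 := ℂ) (s := {w : ℂ | 0 ≤ w.re})
    (f := fun w => Complex.log (1 + w)) (f' := fun w => 1 / (1 + w)) (C := 1) (x := 0) (y := w)
    (fun v hv => by
      have hs : 1 + v ∈ Complex.slitPlane := by
        left
        have hv : 0 ≤ v.re := hv
        simp only [Complex.add_re, Complex.one_re]
        linarith
      simpa using (((hasDerivAt_id v).const_add 1).clog hs).hasDerivWithinAt)
    (fun v hv => by
      rw [norm_div, norm_one]
      exact div_le_one_of_le₀ (one_le_norm_one_add hv) (norm_nonneg _))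
    (convex_halfSpace_re_ge 0) (by simp) hw
  simpa using h

section
variable {ι : Type*} {x : ι → ℝ} {z : ℂ}

theorem re_mul_ofReal_nonneg {y : ℝ} (hy : 0 ≤ y) (hz : 0 < z.re) : 0 ≤ (z * (y : ℂ)).re := by
  simp only [Complex.mul_re, Complex.ofReal_re, Complex.ofReal_im, mul_zero, sub_zero]
  positivity

theorem one_add_mem_slitPlane {w : ℂ} (hw : 0 ≤ w.re) : 1 + w ∈ Complex.slitPlane := by
  left
  simp only [Complex.add_re, Complex.one_re]
  linarith

theorem summable_log_one_add_mul (hx : ∀ i, 0 ≤ x i) (hs : Summable x) (hz : 0 < z.re) :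
    Summable fun i => Complex.log (1 + z * (x i : ℂ)) := by
  refine Summable.of_norm_bounded (g := fun i => ‖z‖ * x i) (hs.mul_left _) fun i => ?_
  refine (norm_log_one_add_le_norm (re_mul_ofReal_nonneg (hx i) hz)).trans ?_
  rw [norm_mul, Complex.norm_real, Real.norm_of_nonneg (hx i)]

theorem norm_div_one_add_mul_le (hx : ∀ i, 0 ≤ x i) (hz : 0 < z.re) (i : ι) :
    ‖(x i : ℂ) / (1 + z * (x i : ℂ))‖ ≤ x i := by
  rw [norm_div, Complex.norm_real, Real.norm_of_nonneg (hx i)]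
  exact div_le_self (hx i) (one_le_norm_one_add (re_mul_ofReal_nonneg (hx i) hz))

theorem hasProd_invSqrtDet (hx : ∀ i, 0 ≤ x i) (hs : Summable x) (hz : 0 < z.re) :
    HasProd (fun i => (1 + z * (x i : ℂ)) ^ (-(1 / 2) : ℂ)) (invSqrtDet x z) := by
  have h := ((summable_log_one_add_mul hx hs hz).hasSum.mul_left (-(1 / 2))).cexp
  unfold invSqrtDet
  convert h using 2 with i
  rw [Complex.cpow_def_of_ne_zero
    (Complex.slitPlane_ne_zero (one_add_mem_slitPlane (re_mul_ofReal_nonneg (hx i) hz))), mul_comm]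
  rfl

/-- The series of logarithms may be differentiated termwise: the derivatives are bounded by the
summable `x i`, uniformly over the half-plane. -/
theorem hasDerivAt_invSqrtDet (hx : ∀ i, 0 ≤ x i) (hs : Summable x) (hz : 0 < z.re) :
    HasDerivAt (invSqrtDet x)
      (-(1 / 2) * (invSqrtDet x z * ∑' j, (x j : ℂ) / (1 + z * (x j : ℂ)))) z := by
  have h := hasDerivAt_tsum_of_isPreconnected (𝕜 := ℂ) (u := x) (t := {z : ℂ | 0 < z.re})
    (g := fun i w => Complex.log (1 + w * (x i : ℂ)))
    (g' := fun i w => (x i : ℂ) / (1 + w * (x i : ℂ))) hs isOpen_rightHalfPlane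
    (convex_halfSpace_re_gt 0).isPreconnected
    (fun i w hw => by
      have h1 := (((hasDerivAt_id w).mul_const (x i : ℂ)).const_add 1).clog
        (one_add_mem_slitPlane (re_mul_ofReal_nonneg (hx i) hw))
      simpa using h1)
    (fun i w hw => norm_div_one_add_mul_le hx hw i) hz (summable_log_one_add_mul hx hs hz) hz
  have h2 := (h.const_mul (-(1 / 2))).cexp
  unfold invSqrtDet
  exact h2.congr_deriv (by ring)

theorem differentiableOn_invSqrtDet (hx : ∀ i, 0 ≤ x i) (hs : Summable x) :
    DifferentiableOn ℂ (invSqrtDet x) {z | 0 < z.re} := fun _ hw =>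
  (hasDerivAt_invSqrtDet hx hs hw).differentiableAt.differentiableWithinAt

/-- Each logarithm has real part `log ‖1 + z x_i‖ ≥ 0`. -/
theorem norm_invSqrtDet_le_one (hx : ∀ i, 0 ≤ x i) (hs : Summable x) (hz : 0 < z.re) :
    ‖invSqrtDet x z‖ ≤ 1 := by
  rw [invSqrtDet, Complex.norm_exp, Real.exp_le_one_iff]
  have h1 : 0 ≤ (∑' i, Complex.log (1 + z * (x i : ℂ))).re := by
    rw [Complex.re_tsum (summable_log_one_add_mul hx hs hz)]
    refine tsum_nonneg fun i => ?_
    rw [Complex.log_re]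
    exact Real.log_nonneg (one_le_norm_one_add (re_mul_ofReal_nonneg (hx i) hz))
  have h2 : (-(1 / 2) : ℂ) = ((-(1 / 2) : ℝ) : ℂ) := by norm_num
  rw [h2, Complex.re_ofReal_mul]
  linarith

/-- The logarithmic derivative of the product is `-1/2` times the sum. This reduces the theorem to
expectations of bounded holomorphic functions. -/
theorem deriv_invSqrtDet (hx : ∀ i, 0 ≤ x i) (hs : Summable x) (hz : 0 < z.re) :
    (∏' i, (1 + z * (x i : ℂ)) ^ (-(1 / 2) : ℂ)) * ∑' j, (x j : ℂ) / (1 + z * (x j : ℂ)) =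
      -2 * deriv (invSqrtDet x) z := by
  rw [(hasDerivAt_invSqrtDet hx hs hz).deriv, (hasProd_invSqrtDet hx hs hz).tprod_eq]
  ring

end

theorem norm_exp_sub_one_le_of_re_nonpos {w : ℂ} (hw : w.re ≤ 0) : ‖Complex.exp w - 1‖ ≤ ‖w‖ := by
  have h := Convex.norm_image_sub_le_of_norm_hasDerivWithin_le (𝕜 := ℂ) (s := {w : ℂ | w.re ≤ 0})
    (f := Complex.exp) (f' := Complex.exp) (C := 1) (x := 0) (y := w)
    (fun v _ => (Complex.hasDerivAt_exp v).hasDerivWithinAt)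
    (fun v hv => by rw [Complex.norm_exp]; exact Real.exp_le_one_iff.mpr hv)
    (convex_halfSpace_re_le 0) (by simp) hw
  simpa using h

theorem norm_exp_sub_one_le_two {w : ℂ} (hw : w.re ≤ 0) : ‖Complex.exp w - 1‖ ≤ 2 := by
  refine (norm_sub_le _ _).trans ?_
  rw [Complex.norm_exp, norm_one]
  linarith [Real.exp_le_one_iff.mpr hw]

/-! ### The intensity -/

theorem cauchyIntensity_eq {x : ℝ} (hx : 0 ≤ x) :
    cauchyIntensity x = Real.pi⁻¹ * x ^ (-(3 / 2) : ℝ) := by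
  rw [cauchyIntensity, Real.rpow_neg hx, one_div, mul_inv]

theorem cauchyIntensity_nonneg {x : ℝ} (hx : 0 ≤ x) : 0 ≤ cauchyIntensity x := by
  rw [cauchyIntensity_eq hx]; positivity

theorem integrableOn_cauchyIntensity {t : ℝ} (ht : 0 < t) :
    IntegrableOn cauchyIntensity (Set.Ioi t) := by
  have h := (integrableOn_Ioi_rpow_of_lt (a := -(3 / 2)) (by norm_num) ht).const_mul Real.pi⁻¹
  exact IntegrableOn.congr_fun h (fun x hx => (cauchyIntensity_eq (ht.le.trans (le_of_lt hx))).symm)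
    measurableSet_Ioi

theorem integral_cauchyIntensity {t : ℝ} (ht : 0 < t) :
    ∫ x in Set.Ioi t, cauchyIntensity x = 2 / Real.pi * t ^ (-(1 / 2) : ℝ) := by
  rw [setIntegral_congr_fun (g := fun x => Real.pi⁻¹ * x ^ (-(3 / 2) : ℝ)) measurableSet_Ioi
    (fun x hx => cauchyIntensity_eq (ht.le.trans (le_of_lt hx))), integral_const_mul,
    integral_Ioi_rpow_of_lt (by norm_num) ht]
  norm_num
  field_simp

theorem measurable_cauchyIntensity : Measurable cauchyIntensity := by
  unfold cauchyIntensity; fun_prop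

/-- Near 0 the linear factor softens `x^(-3/2)` to `x^(-1/2)`; beyond 1 the intensity is itself
integrable. This function dominates the Laplace exponent and its grid approximations. -/
theorem integrableOn_min_mul_cauchyIntensity (C : ℝ) (hC : 0 ≤ C) :
    IntegrableOn (fun x => min 2 (C * x) * cauchyIntensity x) (Set.Ioi 0) := by
  have hm : Measurable (fun x => min 2 (C * x) * cauchyIntensity x) :=
    (measurable_const.min (by fun_prop)).mul measurable_cauchyIntensity
  rw [← Set.Ioc_union_Ioi_eq_Ioi (zero_le_one (α := ℝ))]
  refine IntegrableOn.union ?_ ?_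
  · have h : IntegrableOn (fun x : ℝ => C * Real.pi⁻¹ * x ^ (-(1 / 2) : ℝ)) (Set.Ioc 0 1) := by
      refine Integrable.const_mul ?_ _
      exact (intervalIntegrable_iff_integrableOn_Ioc_of_le zero_le_one).mp
        (intervalIntegral.intervalIntegrable_rpow' (by norm_num))
    refine Integrable.mono' h hm.aestronglyMeasurable ?_
    filter_upwards [ae_restrict_mem measurableSet_Ioc] with x hx
    have hx0 : 0 < x := hx.1
    have h1 : 0 ≤ min 2 (C * x) := le_min (by norm_num) (by positivity)
    rw [norm_mul, Real.norm_of_nonneg h1, Real.norm_of_nonneg (cauchyIntensity_nonneg hx0.le),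
      cauchyIntensity_eq hx0.le]
    have h2 : x ^ (-(1 / 2) : ℝ) = x * x ^ (-(3 / 2) : ℝ) := by
      rw [← Real.rpow_one_add' hx0.le (by norm_num)]; norm_num
    rw [h2]
    calc min 2 (C * x) * (Real.pi⁻¹ * x ^ (-(3 / 2) : ℝ))
        ≤ C * x * (Real.pi⁻¹ * x ^ (-(3 / 2) : ℝ)) :=
          mul_le_mul_of_nonneg_right (min_le_right _ _) (by positivity)
      _ = _ := by ring
  · refine Integrable.mono' ((integrableOn_cauchyIntensity one_pos).const_mul 2)
      hm.aestronglyMeasurable ?_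
    filter_upwards [ae_restrict_mem measurableSet_Ioi] with x hx
    have hx0 : 0 < x := one_pos.trans hx
    have h1 : 0 ≤ min 2 (C * x) := le_min (by norm_num) (by positivity)
    rw [norm_mul, Real.norm_of_nonneg h1, Real.norm_of_nonneg (cauchyIntensity_nonneg hx0.le)]
    exact mul_le_mul_of_nonneg_right (min_le_left _ _) (cauchyIntensity_nonneg hx0.le)

/-! ### The Laplace exponent of the intensity -/

/-- `(1 + z y) ^ (-1/2)` in exponential form. -/
noncomputable def invSqrtOneAdd (z : ℂ) (y : ℝ) : ℂ :=
  Complex.exp (-(1 / 2) * Complex.log (1 + z * (y : ℂ)))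

theorem re_neg_half_log_nonpos {z : ℂ} (hz : 0 < z.re) {y : ℝ} (hy : 0 ≤ y) :
    (-(1 / 2) * Complex.log (1 + z * (y : ℂ))).re ≤ 0 := by
  have h2 : (-(1 / 2) : ℂ) = ((-(1 / 2) : ℝ) : ℂ) := by norm_num
  rw [h2, Complex.re_ofReal_mul, Complex.log_re]
  have := Real.log_nonneg (one_le_norm_one_add (re_mul_ofReal_nonneg hy hz))
  linarith

/-- The bound uses `x` rather than `y`, so that one function of `x` controls every rounding of `x`
from below. -/
theorem norm_invSqrtOneAdd_sub_one_le {z : ℂ} (hz : 0 < z.re) {y x : ℝ} (hy : 0 ≤ y)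
    (hyx : y ≤ x) : ‖invSqrtOneAdd z y - 1‖ ≤ min 2 (‖z‖ * x) := by
  have hre := re_neg_half_log_nonpos hz hy
  refine le_min (norm_exp_sub_one_le_two hre) ((norm_exp_sub_one_le_of_re_nonpos hre).trans ?_)
  have h1 := norm_log_one_add_le_norm (re_mul_ofReal_nonneg hy hz)
  rw [norm_mul z, Complex.norm_real, Real.norm_of_nonneg hy] at h1
  have h2 : ‖z‖ * y ≤ ‖z‖ * x := mul_le_mul_of_nonneg_left hyx (norm_nonneg _)
  rw [norm_mul]
  have h3 : ‖(-(1 / 2) : ℂ)‖ = 1 / 2 := by norm_num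
  rw [h3]
  linarith [norm_nonneg (Complex.log (1 + z * (y : ℂ)))]

theorem continuousOn_invSqrtOneAdd {z : ℂ} (hz : 0 < z.re) :
    ContinuousOn (invSqrtOneAdd z) (Set.Ici 0) := by
  unfold invSqrtOneAdd
  refine Complex.continuous_exp.comp_continuousOn (continuousOn_const.mul ?_)
  refine ContinuousOn.clog (by fun_prop) fun y hy => ?_
  exact one_add_mem_slitPlane (re_mul_ofReal_nonneg hy hz)

theorem measurable_invSqrtOneAdd (z : ℂ) : Measurable (invSqrtOneAdd z) := by
  unfold invSqrtOneAdd; fun_prop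

theorem integrableOn_invSqrtOneAdd {z : ℂ} (hz : 0 < z.re) :
    IntegrableOn (fun x => (invSqrtOneAdd z x - 1) * (cauchyIntensity x : ℂ)) (Set.Ioi 0) := by
  refine Integrable.mono' (integrableOn_min_mul_cauchyIntensity ‖z‖ (norm_nonneg _)) ?_ ?_
  · exact (((measurable_invSqrtOneAdd z).sub_const 1).mul
      (Complex.measurable_ofReal.comp measurable_cauchyIntensity)).aestronglyMeasurable
  · filter_upwards [ae_restrict_mem measurableSet_Ioi] with x hx
    have hx : 0 < x := hx
    rw [norm_mul, Complex.norm_real, Real.norm_of_nonneg (cauchyIntensity_nonneg hx.le)]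
    exact mul_le_mul_of_nonneg_right (norm_invSqrtOneAdd_sub_one_le hz hx.le le_rfl)
      (cauchyIntensity_nonneg hx.le)

/-- For `x > 0`, `√(1 + z x) / √x = √(z + 1/x)` with principal branches, and this tends to `√z`. -/
theorem tendsto_invSqrt_antiderivative {z : ℂ} (hz : 0 < z.re) :
    Tendsto (fun x : ℝ => -(2 / (Real.pi : ℂ)) *
      ((Complex.exp ((1 / 2) * Complex.log (1 + z * (x : ℂ))) - 1) *
        ((x ^ (-(1 / 2) : ℝ) : ℝ) : ℂ))) atTop (𝓝 (-(2 / (Real.pi : ℂ)) * z ^ (1 / 2 : ℂ))) := by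
  refine Tendsto.const_mul _ ?_
  have h0 : Tendsto (fun x : ℝ => ((x ^ (-(1 / 2) : ℝ) : ℝ) : ℂ)) atTop (𝓝 0) := by
    have := (Complex.continuous_ofReal.tendsto 0).comp
      (tendsto_rpow_neg_atTop (y := 1 / 2) (by norm_num))
    simpa [Function.comp_def] using this
  have hzs : z ∈ Complex.slitPlane := Or.inl hz
  have h1 : Tendsto (fun x : ℝ => Complex.exp ((1 / 2) * Complex.log (z + ((x⁻¹ : ℝ) : ℂ)))) atTop
      (𝓝 (z ^ (1 / 2 : ℂ))) := by
    have hi : Tendsto (fun x : ℝ => z + ((x⁻¹ : ℝ) : ℂ)) atTop (𝓝 z) := by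
      have := (Complex.continuous_ofReal.tendsto 0).comp (tendsto_inv_atTop_zero (𝕜 := ℝ))
      simpa [Function.comp_def] using this.const_add z
    rw [Complex.cpow_def_of_ne_zero (Complex.slitPlane_ne_zero hzs), mul_comm]
    exact (Complex.continuous_exp.tendsto _).comp ((hi.clog hzs).const_mul _)
  have h2 := h1.sub h0
  rw [sub_zero] at h2
  refine h2.congr' ?_
  filter_upwards [eventually_gt_atTop 0] with x hx
  have hne : z + ((x⁻¹ : ℝ) : ℂ) ≠ 0 := by
    refine Complex.slitPlane_ne_zero (Or.inl ?_)
    have : 0 < x⁻¹ := by positivity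
    simp only [Complex.add_re, Complex.ofReal_re]
    linarith
  have hxc : (x : ℂ) ≠ 0 := Complex.ofReal_ne_zero.mpr hx.ne'
  have e1 : 1 + z * (x : ℂ) = (x : ℂ) * (z + ((x⁻¹ : ℝ) : ℂ)) := by
    push_cast; field_simp; ring
  have e2 : ((x ^ (-(1 / 2) : ℝ) : ℝ) : ℂ) = Complex.exp (-((1 / 2) * (Real.log x : ℂ))) := by
    rw [Real.rpow_def_of_pos hx]; push_cast; ring_nf
  rw [e1, Complex.log_ofReal_mul hx hne, e2, sub_mul, ← Complex.exp_add, one_mul]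
  ring_nf

theorem norm_exp_half_log_sub_one_le {w : ℂ} (hw : 0 ≤ w.re) :
    ‖Complex.exp ((1 / 2) * Complex.log (1 + w)) - 1‖ ≤ ‖w‖ := by
  have h := Convex.norm_image_sub_le_of_norm_hasDerivWithin_le (𝕜 := ℂ) (s := {w : ℂ | 0 ≤ w.re})
    (f := fun w => Complex.exp ((1 / 2) * Complex.log (1 + w)))
    (f' := fun w => Complex.exp ((1 / 2) * Complex.log (1 + w)) * ((1 / 2) * (1 / (1 + w))))
    (C := 1) (x := 0) (y := w)
    (fun v hv => by
      have := (((hasDerivAt_id v).const_add 1).clog (one_add_mem_slitPlane hv))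
      exact (this.const_mul (1 / 2)).cexp.hasDerivWithinAt)
    (fun v hv => by
      have h1 := one_le_norm_one_add hv
      have e : ‖Complex.exp ((1 / 2) * Complex.log (1 + v))‖ ≤ ‖1 + v‖ := by
        have h2 : (1 / 2 : ℂ) = ((1 / 2 : ℝ) : ℂ) := by norm_num
        rw [Complex.norm_exp, h2, Complex.re_ofReal_mul, Complex.log_re]
        calc Real.exp (1 / 2 * Real.log ‖1 + v‖) ≤ Real.exp (Real.log ‖1 + v‖) := by
              apply Real.exp_le_exp.mpr
              linarith [Real.log_nonneg h1]
          _ = ‖1 + v‖ := Real.exp_log (by linarith)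
      have h3 : ‖(1 / 2 : ℂ)‖ = 1 / 2 := by norm_num
      rw [norm_mul, norm_mul, h3, norm_div, norm_one]
      calc _ ≤ ‖1 + v‖ * (1 / 2 * (1 / ‖1 + v‖)) :=
            mul_le_mul_of_nonneg_right e (by positivity)
        _ = 1 / 2 := by field_simp
        _ ≤ 1 := by norm_num)
    (convex_halfSpace_re_ge 0) (by simp) hw
  simpa using h

/-- An explicit antiderivative is `-(2/π) (√(1 + z x) - 1) / √x`, which vanishes at 0 and tends to
`-(2/π)√z` at infinity. -/
theorem integral_invSqrtOneAdd {z : ℂ} (hz : 0 < z.re) :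
    ∫ x in Set.Ioi 0, (invSqrtOneAdd z x - 1) * (cauchyIntensity x : ℂ) =
      -(2 / (Real.pi : ℂ)) * z ^ (1 / 2 : ℂ) := by
  have hpi : (Real.pi : ℂ) ≠ 0 := Complex.ofReal_ne_zero.mpr Real.pi_ne_zero
  have hF := integral_Ioi_of_hasDerivAt_of_tendsto (a := 0)
    (f := fun x : ℝ => -(2 / (Real.pi : ℂ)) *
      ((Complex.exp ((1 / 2) * Complex.log (1 + z * (x : ℂ))) - 1) *
        ((x ^ (-(1 / 2) : ℝ) : ℝ) : ℂ)))
    (f' := fun x => (invSqrtOneAdd z x - 1) * (cauchyIntensity x : ℂ)) ?_ ?_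
    (integrableOn_invSqrtOneAdd hz) (tendsto_invSqrt_antiderivative hz)
  · rw [hF]; simp
  -- Continuity at 0: `√(1 + z x) - 1` is at most `‖z‖ x` in norm, which beats `x^(-1/2)`.
  · rw [ContinuousWithinAt]
    have hz0 : -(2 / (Real.pi : ℂ)) * ((Complex.exp ((1 / 2) * Complex.log (1 + z * ((0 : ℝ) : ℂ)))
        - 1) * (((0 : ℝ) ^ (-(1 / 2) : ℝ) : ℝ) : ℂ)) = 0 := by simp
    rw [hz0]
    have hlim : Tendsto (fun x : ℝ => 2 / Real.pi * ‖z‖ * x ^ (1 / 2 : ℝ)) (𝓝[≥] 0) (𝓝 0) := by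
      have hc : Continuous fun x : ℝ => 2 / Real.pi * ‖z‖ * x ^ (1 / 2 : ℝ) :=
        continuous_const.mul (Real.continuous_rpow_const (by norm_num))
      have := hc.tendsto 0
      rw [Real.zero_rpow (by norm_num), mul_zero] at this
      exact this.mono_left nhdsWithin_le_nhds
    refine squeeze_zero_norm' ?_ hlim
    filter_upwards [self_mem_nhdsWithin] with x hx
    rcases (show (0 : ℝ) ≤ x from hx).eq_or_lt with rfl | hx
    · simp
    have h1 := norm_exp_half_log_sub_one_le (re_mul_ofReal_nonneg hx.le hz)
    rw [norm_mul z, Complex.norm_real, Real.norm_of_nonneg hx.le] at h1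
    have h2 : ‖-(2 / (Real.pi : ℂ))‖ = 2 / Real.pi := by
      rw [norm_neg, norm_div, Complex.norm_real, Real.norm_of_nonneg Real.pi_pos.le]; simp
    have h3 : x ^ (1 / 2 : ℝ) = x * x ^ (-(1 / 2) : ℝ) := by
      rw [← Real.rpow_one_add' hx.le (by norm_num)]; norm_num
    rw [norm_mul, norm_mul, h2, Complex.norm_real, Real.norm_of_nonneg (by positivity), h3]
    calc _ ≤ 2 / Real.pi * (‖z‖ * x * x ^ (-(1 / 2) : ℝ)) := by gcongr
      _ = _ := by ring
  · intro x hx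
    have hx : 0 < x := hx
    have hs := one_add_mem_slitPlane (re_mul_ofReal_nonneg hx.le hz)
    have hd : HasDerivAt (fun w : ℂ => Complex.exp ((1 / 2) * Complex.log (1 + z * w)))
        (Complex.exp ((1 / 2) * Complex.log (1 + z * (x : ℂ))) *
          ((1 / 2) * (z / (1 + z * (x : ℂ))))) (x : ℂ) := by
      have h1 : HasDerivAt (fun w : ℂ => 1 + z * w) z (x : ℂ) := by
        simpa using ((hasDerivAt_id (x : ℂ)).const_mul z).const_add 1
      exact ((h1.clog hs).const_mul (1 / 2)).cexp
    have hr := (Real.hasDerivAt_rpow_const (x := x) (p := -(1 / 2)) (Or.inl hx.ne')).ofReal_comp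
    have := ((hd.comp_ofReal.sub_const 1).mul hr).const_mul (-(2 / (Real.pi : ℂ)))
    refine this.congr_deriv ?_
    -- With `S = √(1 + z x)` and `z x = S² - 1`, the derivative becomes `π⁻¹ x^(-3/2) ((S - 1) - (S²
    -- - 1)/S) = π⁻¹ x^(-3/2) (S⁻¹ - 1)`.
    set S := Complex.exp ((1 / 2) * Complex.log (1 + z * (x : ℂ))) with hS
    have hne := Complex.slitPlane_ne_zero hs
    have hSS : S * S = 1 + z * (x : ℂ) := by
      rw [hS, ← Complex.exp_add, ← add_mul]
      norm_num
      exact Complex.exp_log hne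
    have hS0 : S ≠ 0 := Complex.exp_ne_zero _
    have hinv : invSqrtOneAdd z x = S⁻¹ := by
      rw [invSqrtOneAdd, hS, ← Complex.exp_neg]; ring_nf
    have e2 : x ^ (-(1 / 2) : ℝ) = x * x ^ (-(3 / 2) : ℝ) := by
      rw [← Real.rpow_one_add' hx.le (by norm_num)]; norm_num
    have e3 : (-(1 / 2) - 1 : ℝ) = -(3 / 2) := by norm_num
    rw [cauchyIntensity_eq hx.le, hinv, e3, e2, ← hSS]
    have hzx : z * (x : ℂ) = S * S - 1 := by rw [hSS]; ring
    push_cast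
    generalize ((x ^ (-(3 / 2) : ℝ) : ℝ) : ℂ) = r
    have : z / (S * S) * (x * r) = (S * S - 1) / (S * S) * r := by rw [← hzx]; ring
    have e4 : S * (1 / 2 * (z / (S * S))) * (x * r) = S * (1 / 2) * ((S * S - 1) / (S * S) * r) := by
      rw [← this]; ring
    rw [e4]
    field_simp
    ring

/-! ### Poisson counts and almost sure summability of the points -/

theorem integral_pow_toNat_of_hasLaw_poisson {Ω : Type*} [MeasurableSpace Ω] {P : Measure Ω}
    {N : Ω → ℕ∞} {r : NNReal}
    (h : HasLaw N ((poissonMeasure r).map (Nat.cast : ℕ → ℕ∞)) P) (c : ℂ) :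
    ∫ ω, c ^ (N ω).toNat ∂P = Complex.exp ((c - 1) * (r : ℝ)) := by
  -- The law lives on finite counts, so the convention that `toNat` sends `⊤` to 0 is harmless.
  have h1 := h.integral_comp (f := fun k : ℕ∞ => c ^ k.toNat) .of_discrete
  simp only [Function.comp_def] at h1
  rw [h1, integral_map .of_discrete .of_discrete, integral_poissonMeasure]
  have h2 := (NormedSpace.expSeries_div_hasSum_exp (𝔸 := ℂ) (c * ((r : ℝ) : ℂ))).mul_left
    (Complex.exp (-((r : ℝ) : ℂ)))
  rw [← Complex.exp_eq_exp_ℂ, ← Complex.exp_add] at h2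
  rw [show (c - 1) * ((r : ℝ) : ℂ) = -((r : ℝ) : ℂ) + c * ((r : ℝ) : ℂ) by ring, ← h2.tsum_eq]
  refine tsum_congr fun n => ?_
  rw [Complex.real_smul, mul_pow]
  simp only [ENat.toNat_natCast]
  push_cast
  ring

theorem lintegral_natCast_poissonMeasure (r : NNReal) :
    ∫⁻ n : ℕ, (n : ENNReal) ∂(poissonMeasure r) = r := by
  rw [lintegral_countable']
  -- The identity `(n+1) P(n+1) = r P(n)` shifts the series for the mean into `r` times the total
  -- mass.
  have h1 : ∀ n : ℕ, ((n + 1 : ℕ) : ENNReal) * poissonMeasure r {n + 1} =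
      r * poissonMeasure r {n} := by
    intro n
    have hr : ENNReal.ofReal (r : ℝ) = r := ENNReal.ofReal_coe_nnreal
    rw [poissonMeasure_singleton, poissonMeasure_singleton, ← ENNReal.ofReal_natCast,
      ← ENNReal.ofReal_mul (by positivity), ← hr, ← ENNReal.ofReal_mul (by positivity)]
    congr 1
    rw [Nat.factorial_succ]
    push_cast
    field_simp
    ring
  rw [tsum_eq_zero_add' ENNReal.summable]
  simp_rw [h1]
  rw [ENNReal.tsum_mul_left]
  have h2 : ∑' n : ℕ, poissonMeasure r {n} = 1 := by
    have := lintegral_countable' (μ := poissonMeasure r) (fun _ => 1)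
    simpa using this.symm
  rw [h2]
  simp

theorem lintegral_toENNReal_of_hasLaw_poisson {Ω : Type*} [MeasurableSpace Ω] {P : Measure Ω}
    {N : Ω → ℕ∞} {r : NNReal}
    (h : HasLaw N ((poissonMeasure r).map (Nat.cast : ℕ → ℕ∞)) P) :
    ∫⁻ ω, (N ω : ENNReal) ∂P = r := by
  rw [← lintegral_map' (f := fun k : ℕ∞ => (k : ENNReal)) (Measurable.of_discrete).aemeasurable
    h.aemeasurable, h.map_eq, lintegral_map .of_discrete .of_discrete]
  simpa using lintegral_natCast_poissonMeasure r

theorem toENNReal_pointCount {Ω : Type*} (X : ℕ → Ω → ℝ) (I : Set ℝ) (ω : Ω) :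
    (pointCount X I ω : ENNReal) = ∑' i, I.indicator 1 (X i ω) := by
  rw [pointCount, ← ENNReal.tsum_set_one, tsum_subtype {i | X i ω ∈ I} (fun _ => (1 : ENNReal))]
  rfl

theorem measurable_pointCount {Ω : Type*} [MeasurableSpace Ω] {X : ℕ → Ω → ℝ}
    (hX : ∀ i, Measurable (X i)) {I : Set ℝ} (hI : MeasurableSet I) :
    Measurable (pointCount X I) := by
  have h : Measurable fun ω => (pointCount X I ω : ENNReal) := by
    simp_rw [toENNReal_pointCount]
    exact Measurable.tsum fun i => (measurable_one.indicator hI).comp (hX i)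
  refine measurable_to_countable' fun n => ?_
  have : pointCount X I ⁻¹' {n} = (fun ω => (pointCount X I ω : ENNReal)) ⁻¹' {(n : ENNReal)} := by
    ext ω; simp
  rw [this]
  exact h (measurableSet_singleton _)

namespace IsPoissonPointProcess

variable {Ω : Type*} [MeasurableSpace Ω] {Q : Measure Ω}
  {X : ℕ → Ω → ℝ}

theorem lintegral_pointCount_Ioi (h : IsPoissonPointProcess Q cauchyIntensity X) {t : ℝ}
    (ht : 0 < t) : ∫⁻ ω, (pointCount X (Set.Ioi t) ω : ENNReal) ∂Q =
      ENNReal.ofReal (2 / Real.pi * t ^ (-(1 / 2) : ℝ)) := by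
  rw [lintegral_toENNReal_of_hasLaw_poisson (h.count_law (Set.Ioi t) Set.ordConnected_Ioi
    (Set.Ioi_subset_Ioi ht.le) (integrableOn_cauchyIntensity ht)), integral_cauchyIntensity ht]
  rfl

/-- Layer-cake formula: `E ∑ min(X_i, 1) = ∫₀¹ E #{i : X_i > t} dt = ∫₀¹ (2/π) t^(-1/2) dt`, which
is finite. -/
theorem ae_summable [IsProbabilityMeasure Q] (h : IsPoissonPointProcess Q cauchyIntensity X) :
    ∀ᵐ ω ∂Q, Summable fun i => X i ω := by
  have hmin : ∀ x : ℝ, 0 < x → ENNReal.ofReal (min x 1) =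
      ∫⁻ t in Set.Ioo 0 1, (Set.Ioi t).indicator 1 x := by
    intro x hx
    have : ∀ t : ℝ, (Set.Ioi t).indicator (1 : ℝ → ENNReal) x = (Set.Iio x).indicator 1 t := by
      intro t; simp [Set.indicator]
    simp_rw [this]
    rw [lintegral_indicator_one measurableSet_Iio, Measure.restrict_apply measurableSet_Iio,
      Set.inter_comm, Set.Ioo_inter_Iio, Real.volume_Ioo, min_comm, sub_zero]
  have hmeas : Measurable fun p : ℝ × Ω => ∑' i, (Set.Ioi p.1).indicator (1 : ℝ → ENNReal) (X i p.2) := by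
    refine Measurable.tsum fun i => ?_
    have : (fun p : ℝ × Ω => (Set.Ioi p.1).indicator (1 : ℝ → ENNReal) (X i p.2)) =
        {p : ℝ × Ω | p.1 < X i p.2}.indicator 1 := by
      ext p; simp [Set.indicator]
    rw [this]
    exact measurable_one.indicator (measurableSet_lt measurable_fst ((h.measurable i).comp measurable_snd))
  have hlint : ∫⁻ ω, ∑' i, ENNReal.ofReal (min (X i ω) 1) ∂Q ≠ ⊤ := by
    have e1 : ∀ ω, ∑' i, ENNReal.ofReal (min (X i ω) 1) =
        ∫⁻ t in Set.Ioo 0 1, ∑' i, (Set.Ioi t).indicator 1 (X i ω) := by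
      intro ω
      rw [lintegral_tsum]
      · exact tsum_congr fun i => hmin _ (h.pos i ω)
      · intro i
        have : (fun t : ℝ => (Set.Ioi t).indicator (1 : ℝ → ENNReal) (X i ω)) =
            (Set.Iio (X i ω)).indicator 1 := by
          ext t; simp [Set.indicator]
        rw [this]
        exact (measurable_one.indicator measurableSet_Iio).aemeasurable
    simp_rw [e1]
    rw [lintegral_lintegral_swap (f := fun ω t => ∑' i, (Set.Ioi t).indicator 1 (X i ω))
      (hmeas.comp measurable_swap).aemeasurable]
    have e2 : ∫⁻ t in Set.Ioo (0 : ℝ) 1, ∫⁻ ω, ∑' i, (Set.Ioi t).indicator 1 (X i ω) ∂Q =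
        ∫⁻ t in Set.Ioo (0 : ℝ) 1, ENNReal.ofReal (2 / Real.pi * t ^ (-(1 / 2) : ℝ)) := by
      refine setLIntegral_congr_fun measurableSet_Ioo fun t ht => ?_
      rw [← h.lintegral_pointCount_Ioi ht.1]
      simp_rw [toENNReal_pointCount]
    rw [e2]
    have hi : IntegrableOn (fun t : ℝ => 2 / Real.pi * t ^ (-(1 / 2) : ℝ)) (Set.Ioo 0 1) := by
      refine Integrable.const_mul ?_ _
      refine IntegrableOn.mono_set ?_ Set.Ioo_subset_Ioc_self
      exact (intervalIntegrable_iff_integrableOn_Ioc_of_le zero_le_one).mp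
        (intervalIntegral.intervalIntegrable_rpow' (by norm_num))
    exact hi.lintegral_lt_top.ne
  have hfin1 : ∀ᵐ ω ∂Q, ∑' i, ENNReal.ofReal (min (X i ω) 1) < ⊤ := by
    refine ae_lt_top (Measurable.tsum fun i => ?_) hlint
    exact ((h.measurable i).min measurable_const).ennreal_ofReal
  filter_upwards [hfin1] with ω h1
  have hs : Summable fun i => min (X i ω) 1 := by
    have := ENNReal.summable_toReal h1.ne
    refine this.congr fun i => ?_
    rw [ENNReal.toReal_ofReal (le_min (h.pos i ω).le zero_le_one)]
  -- The terms of a convergent series are eventually below 1, so the truncation alters only finitely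
  -- many of them.
  refine hs.congr_cofinite ?_
  filter_upwards [hs.tendsto_cofinite_zero.eventually_lt_const one_pos] with i hi
  exact min_eq_left (by rcases min_lt_iff.mp hi with h | h <;> linarith)

end IsPoissonPointProcess

/-! ### Discretisation of the positive half-axis -/

/-- The index of the cell of `x` in the grid of mesh `1 / k` cut off at `k`. -/
noncomputable def gridIndex (k : ℕ) (x : ℝ) : Fin (k ^ 2 + 1) :=
  ⟨min ⌊(k : ℝ) * x⌋₊ (k ^ 2), Nat.lt_succ_of_le (min_le_right _ _)⟩

/-- The lower end of a cell. -/
noncomputable def gridPoint (k : ℕ) (j : Fin (k ^ 2 + 1)) : ℝ := (j : ℝ) / k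

/-- The cells of the grid. -/
def gridCell (k : ℕ) (j : Fin (k ^ 2 + 1)) : Set ℝ := Set.Ioi 0 ∩ gridIndex k ⁻¹' {j}

theorem gridPoint_nonneg (k : ℕ) (j : Fin (k ^ 2 + 1)) : 0 ≤ gridPoint k j := by
  unfold gridPoint; positivity

theorem monotone_gridIndex (k : ℕ) : Monotone (gridIndex k) := by
  intro x y hxy
  simp only [gridIndex, Fin.mk_le_mk]
  exact min_le_min_right _ (Nat.floor_mono (by gcongr))

theorem ordConnected_gridCell (k : ℕ) (j : Fin (k ^ 2 + 1)) : (gridCell k j).OrdConnected :=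
  Set.ordConnected_Ioi.inter (Set.ordConnected_singleton.preimage_mono (monotone_gridIndex k))

theorem pairwise_disjoint_gridCell (k : ℕ) :
    Pairwise (fun i j => Disjoint (gridCell k i) (gridCell k j)) := by
  intro i j hij
  rw [Set.disjoint_left]
  rintro x ⟨_, h1⟩ ⟨_, h2⟩
  exact hij (h1.symm.trans h2)

theorem iUnion_gridCell (k : ℕ) : ⋃ j, gridCell k j = Set.Ioi 0 := by
  ext x; simp [gridCell]

theorem gridPoint_gridIndex_le (k : ℕ) {x : ℝ} (hx : 0 ≤ x) : gridPoint k (gridIndex k x) ≤ x := by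
  rcases k.eq_zero_or_pos with rfl | hk
  · simpa [gridPoint] using hx
  have hk' : (0 : ℝ) < k := by exact_mod_cast hk
  rw [gridPoint, div_le_iff₀ hk']
  calc ((gridIndex k x : ℕ) : ℝ) ≤ (⌊(k : ℝ) * x⌋₊ : ℝ) := by
        exact_mod_cast min_le_left _ _
    _ ≤ k * x := Nat.floor_le (by positivity)
    _ = x * k := mul_comm _ _

/-- Only cell 0 accumulates at 0, so every other cell has finite intensity. The crude bound replaces
`1 / k` and stays positive without assuming `k ≠ 0`. -/
theorem gridCell_subset {k : ℕ} {j : Fin (k ^ 2 + 1)} (hj : (j : ℕ) ≠ 0) :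
    gridCell k j ⊆ Set.Ioi (1 / (2 * ((k : ℝ) + 1))) := by
  rintro x ⟨hx, h⟩
  have hx : 0 < x := hx
  have h1 : 1 ≤ ⌊(k : ℝ) * x⌋₊ := by
    have h2 : ((gridIndex k x : Fin _) : ℕ) = j := congrArg _ h
    have h3 : ((gridIndex k x : Fin _) : ℕ) ≤ ⌊(k : ℝ) * x⌋₊ := min_le_left _ _
    omega
  have h2 : (1 : ℝ) ≤ k * x := by
    have := Nat.floor_le (show (0 : ℝ) ≤ k * x by positivity)
    have h3 : (1 : ℝ) ≤ (⌊(k : ℝ) * x⌋₊ : ℝ) := by exact_mod_cast h1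
    linarith
  rw [Set.mem_Ioi, div_lt_iff₀ (by positivity)]
  nlinarith

theorem tendsto_gridPoint_gridIndex {x : ℝ} (hx : 0 ≤ x) :
    Tendsto (fun k => gridPoint k (gridIndex k x)) atTop (𝓝 x) := by
  have h0 : Tendsto (fun k : ℕ => x - 1 / (k : ℝ)) atTop (𝓝 x) := by
    simpa using (tendsto_const_nhds (x := x)).sub (tendsto_one_div_atTop_nhds_zero_nat (𝕜 := ℝ))
  refine tendsto_of_tendsto_of_tendsto_of_le_of_le' h0 tendsto_const_nhds ?_
    (Eventually.of_forall fun k => gridPoint_gridIndex_le k hx)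
  -- Once `k ≥ x` the cutoff `k²` is inactive, and rounding down loses at most `1 / k`.
  filter_upwards [eventually_ge_atTop (⌈x⌉₊ + 1)] with k hk
  have hk1 : (x : ℝ) ≤ k := (Nat.le_ceil x).trans (by exact_mod_cast (by omega))
  have hk0 : (0 : ℝ) < k := by exact_mod_cast (by omega : 0 < k)
  have h1 : ⌊(k : ℝ) * x⌋₊ ≤ k ^ 2 := by
    have : (k : ℝ) * x ≤ ((k ^ 2 : ℕ) : ℝ) := by push_cast; nlinarith
    exact (Nat.floor_mono this).trans (by rw [Nat.floor_natCast])
  have h2 : ((gridIndex k x : Fin _) : ℕ) = ⌊(k : ℝ) * x⌋₊ := min_eq_left h1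
  rw [gridPoint, h2, le_div_iff₀ hk0, sub_mul, one_div_mul_cancel hk0.ne']
  have := Nat.lt_floor_add_one ((k : ℝ) * x)
  linarith

/-! ### Products over rounded points and the Laplace functional -/

theorem hasProd_invSqrtOneAdd {ι : Type*} {x : ι → ℝ} {z : ℂ} (hx : ∀ i, 0 ≤ x i)
    (hs : Summable x) (hz : 0 < z.re) :
    HasProd (fun i => invSqrtOneAdd z (x i)) (invSqrtDet x z) :=
  ((summable_log_one_add_mul hx hs hz).hasSum.mul_left (-(1 / 2))).cexp

theorem tendsto_invSqrtDet {ι : Type*} {x : ι → ℝ} {y : ℕ → ι → ℝ} {z : ℂ} (hy : ∀ k i, 0 ≤ y k i)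
    (hyx : ∀ k i, y k i ≤ x i) (hs : Summable x) (hz : 0 < z.re)
    (hlim : ∀ i, Tendsto (fun k => y k i) atTop (𝓝 (x i))) :
    Tendsto (fun k => invSqrtDet (y k) z) atTop (𝓝 (invSqrtDet x z)) := by
  refine (Complex.continuous_exp.tendsto _).comp (Tendsto.const_mul _ ?_)
  refine tendsto_tsum_of_dominated_convergence (bound := fun i => ‖z‖ * x i) (hs.mul_left _) ?_ ?_
  · intro i
    refine Tendsto.clog ?_ (one_add_mem_slitPlane (re_mul_ofReal_nonneg ((hy 0 i).trans (hyx 0 i)) hz))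
    exact (((Complex.continuous_ofReal.tendsto _).comp (hlim i)).const_mul z).const_add 1
  · refine Eventually.of_forall fun k i => ?_
    refine (norm_log_one_add_le_norm (re_mul_ofReal_nonneg (hy k i) hz)).trans ?_
    rw [norm_mul, Complex.norm_real, Real.norm_of_nonneg (hy k i)]
    exact mul_le_mul_of_nonneg_left (hyx k i) (norm_nonneg _)

theorem aestronglyMeasurable_invSqrtDet {Ω : Type*} [MeasurableSpace Ω] {Q : Measure Ω}
    {X : ℕ → Ω → ℝ} (hX : ∀ i, Measurable (X i)) (hpos : ∀ i ω, 0 ≤ X i ω)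
    (hs : ∀ᵐ ω ∂Q, Summable fun i => X i ω) {z : ℂ} (hz : 0 < z.re) :
    AEStronglyMeasurable (fun ω => invSqrtDet (fun i => X i ω) z) Q := by
  refine aestronglyMeasurable_of_tendsto_ae atTop
    (f := fun n ω => ∏ i ∈ Finset.range n, invSqrtOneAdd z (X i ω)) (fun n => ?_) ?_
  · exact (Finset.measurable_fun_prod _ fun i _ =>
      (measurable_invSqrtOneAdd z).comp (hX i)).aestronglyMeasurable
  · filter_upwards [hs] with ω hω
    exact (hasProd_invSqrtOneAdd (fun i => hpos i ω) hω hz).tendsto_prod_nat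

/-- Equal factors are grouped by cell. Cell 0 may hold infinitely many points, but its grid point is
0 and its factor 1; by summability the others hold finitely many. -/
theorem invSqrtDet_grid {x : ℕ → ℝ} (hx : ∀ i, 0 < x i) (hs : Summable x) {z : ℂ} (hz : 0 < z.re)
    (k : ℕ) : invSqrtDet (fun i => gridPoint k (gridIndex k (x i))) z =
      ∏ j, invSqrtOneAdd z (gridPoint k j) ^ {i | x i ∈ gridCell k j}.encard.toNat := by
  have hfin : {i | (gridIndex k (x i) : ℕ) ≠ 0}.Finite := by
    have h1 : ∀ᶠ i in cofinite, x i < 1 / (2 * ((k : ℝ) + 1)) :=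
      hs.tendsto_cofinite_zero.eventually_lt_const (by positivity)
    refine (Filter.eventually_cofinite.mp h1).subset fun i hi => ?_
    have : x i ∈ gridCell k (gridIndex k (x i)) := ⟨hx i, rfl⟩
    exact not_lt.mpr (le_of_lt (gridCell_subset hi this))
  have hone : ∀ j : Fin (k ^ 2 + 1), (j : ℕ) = 0 → invSqrtOneAdd z (gridPoint k j) = 1 := by
    intro j hj
    simp [invSqrtOneAdd, gridPoint, hj]
  have h0 : ∀ i, 0 ≤ gridPoint k (gridIndex k (x i)) := fun i => gridPoint_nonneg _ _
  have hsum : Summable fun i => gridPoint k (gridIndex k (x i)) :=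
    Summable.of_nonneg_of_le h0 (fun i => gridPoint_gridIndex_le k (hx i).le) hs
  have hp := hasProd_prod_of_ne_finset_one (L := SummationFilter.unconditional ℕ)
    (f := fun i => invSqrtOneAdd z (gridPoint k (gridIndex k (x i))))
    (s := hfin.toFinset) (fun i hi => hone _ (by simpa using hi))
  rw [(hasProd_invSqrtOneAdd h0 hsum hz).unique hp,
    ← Finset.prod_fiberwise hfin.toFinset (fun i => gridIndex k (x i))]
  refine Finset.prod_congr rfl fun j _ => ?_
  rw [Finset.prod_congr rfl (g := fun _ => invSqrtOneAdd z (gridPoint k j))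
    (fun i hi => by rw [(Finset.mem_filter.mp hi).2]), Finset.prod_const]
  by_cases hj : (j : ℕ) = 0
  · simp [hone j hj]
  · congr 1
    have : {i | x i ∈ gridCell k j} =
        ((hfin.toFinset.filter fun i => gridIndex k (x i) = j : Finset ℕ) : Set ℕ) := by
      ext i
      simp only [gridCell, Set.mem_inter_iff, Set.mem_Ioi, Set.mem_preimage,
        Set.mem_singleton_iff, Set.mem_ofPred_eq, Finset.coe_filter, Set.Finite.mem_toFinset, hx i,
        true_and]
      constructor
      · rintro rfl; exact ⟨hj, rfl⟩
      · exact fun h => h.2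
    rw [this, Set.encard_coe_eq_coe_finsetCard]
    rfl

namespace IsPoissonPointProcess

variable {Ω : Type*} [MeasurableSpace Ω] {Q : Measure Ω} [IsProbabilityMeasure Q]
  {X : ℕ → Ω → ℝ}

/-- Laplace functional of a step function: the cells are disjoint intervals, so the counts are
independent and the Poisson generating functions multiply. -/
theorem integral_invSqrtDet_grid (h : IsPoissonPointProcess Q cauchyIntensity X) {z : ℂ}
    (hz : 0 < z.re) (k : ℕ) :
    ∫ ω, invSqrtDet (fun i => gridPoint k (gridIndex k (X i ω))) z ∂Q =
      Complex.exp (∫ x in Set.Ioi 0, (invSqrtOneAdd z (gridPoint k (gridIndex k x)) - 1) *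
        (cauchyIntensity x : ℂ)) := by
  have hmc : ∀ j, MeasurableSet (gridCell k j) := fun j => (ordConnected_gridCell k j).measurableSet
  have e1 : ∫ ω, invSqrtDet (fun i => gridPoint k (gridIndex k (X i ω))) z ∂Q =
      ∫ ω, ∏ j, invSqrtOneAdd z (gridPoint k j) ^ (pointCount X (gridCell k j) ω).toNat ∂Q := by
    refine integral_congr_ae ?_
    filter_upwards [h.ae_summable] with ω hω
    exact invSqrtDet_grid (fun i => h.pos i ω) hω hz k
  have hind := h.count_indep (k ^ 2 + 1) (gridCell k) (ordConnected_gridCell k)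
    (fun j => Set.inter_subset_left) (pairwise_disjoint_gridCell k)
  rw [e1, hind.integral_fun_prod_comp
    (f := fun j (N : ℕ∞) => invSqrtOneAdd z (gridPoint k j) ^ N.toNat)
    (fun j => (measurable_pointCount h.measurable (hmc j)).aemeasurable)
    (fun j => .of_discrete)]
  have e2 : ∀ j, ∫ ω, invSqrtOneAdd z (gridPoint k j) ^ (pointCount X (gridCell k j) ω).toNat ∂Q =
      Complex.exp (∫ x in gridCell k j, (invSqrtOneAdd z (gridPoint k (gridIndex k x)) - 1) *
        (cauchyIntensity x : ℂ)) ∧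
      IntegrableOn (fun x => (invSqrtOneAdd z (gridPoint k (gridIndex k x)) - 1) *
        (cauchyIntensity x : ℂ)) (gridCell k j) := by
    intro j
    have hcongr : ∀ x ∈ gridCell k j, (invSqrtOneAdd z (gridPoint k (gridIndex k x)) - 1) *
        (cauchyIntensity x : ℂ) = (invSqrtOneAdd z (gridPoint k j) - 1) * (cauchyIntensity x : ℂ) := by
      intro x hx
      rw [show gridIndex k x = j from hx.2]
    rw [integrableOn_congr_fun hcongr (hmc j), setIntegral_congr_fun (hmc j) hcongr]
    -- On cell 0 the intensity is not assumed integrable; the factor is 1 and the integrand is 0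
    -- there.
    by_cases hj : (j : ℕ) = 0
    · simp [invSqrtOneAdd, gridPoint, hj]
    · have hI : IntegrableOn cauchyIntensity (gridCell k j) :=
        (integrableOn_cauchyIntensity (by positivity)).mono_set (gridCell_subset hj)
      refine ⟨?_, hI.ofReal.const_mul _⟩
      rw [integral_pow_toNat_of_hasLaw_poisson (h.count_law (gridCell k j)
        (ordConnected_gridCell k j) Set.inter_subset_left hI), integral_const_mul,
        integral_complex_ofReal, Real.coe_toNNReal]
      exact setIntegral_nonneg (hmc j) fun x hx => cauchyIntensity_nonneg (le_of_lt hx.1)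
  rw [Finset.prod_congr rfl fun j _ => (e2 j).1, ← Complex.exp_sum, ← iUnion_gridCell k,
    integral_iUnion_fintype hmc (pairwise_disjoint_gridCell k) (fun j => (e2 j).2)]

/-- The mesh tends to 0 in the grid identity. Dominated convergence applies to both sides: the
products are bounded by 1, the exponents by `min(2, ‖z‖ x) ρ(x)`. -/
theorem integral_invSqrtDet (h : IsPoissonPointProcess Q cauchyIntensity X) {z : ℂ}
    (hz : 0 < z.re) : ∫ ω, invSqrtDet (fun i => X i ω) z ∂Q =
      Complex.exp (-(2 / (Real.pi : ℂ)) * z ^ (1 / 2 : ℂ)) := by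
  have hmono : ∀ k, Measurable (fun x => gridPoint k (gridIndex k x)) := fun k => by
    have : Measurable (gridIndex k) := (monotone_gridIndex k).measurable
    exact (Measurable.of_discrete (f := gridPoint k)).comp this
  have h1 : Tendsto (fun k => ∫ ω, invSqrtDet (fun i => gridPoint k (gridIndex k (X i ω))) z ∂Q)
      atTop (𝓝 (∫ ω, invSqrtDet (fun i => X i ω) z ∂Q)) := by
    have hs : ∀ k, ∀ᵐ ω ∂Q, Summable fun i => gridPoint k (gridIndex k (X i ω)) := by
      intro k
      filter_upwards [h.ae_summable] with ω hω
      exact Summable.of_nonneg_of_le (fun i => gridPoint_nonneg _ _)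
        (fun i => gridPoint_gridIndex_le k (h.pos i ω).le) hω
    refine tendsto_integral_filter_of_dominated_convergence (fun _ => 1) ?_ ?_
      (integrable_const _) ?_
    · exact Eventually.of_forall fun k => aestronglyMeasurable_invSqrtDet
        (fun i => (hmono k).comp (h.measurable i)) (fun i ω => gridPoint_nonneg _ _) (hs k) hz
    · refine Eventually.of_forall fun k => ?_
      filter_upwards [hs k] with ω hω
      exact norm_invSqrtDet_le_one (fun i => gridPoint_nonneg _ _) hω hz
    · filter_upwards [h.ae_summable] with ω hω
      exact tendsto_invSqrtDet (fun k i => gridPoint_nonneg _ _)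
        (fun k i => gridPoint_gridIndex_le k (h.pos i ω).le) hω hz
        (fun i => tendsto_gridPoint_gridIndex (h.pos i ω).le)
  have h2 : Tendsto (fun k => ∫ x in Set.Ioi 0,
      (invSqrtOneAdd z (gridPoint k (gridIndex k x)) - 1) * (cauchyIntensity x : ℂ)) atTop
      (𝓝 (∫ x in Set.Ioi 0, (invSqrtOneAdd z x - 1) * (cauchyIntensity x : ℂ))) := by
    refine tendsto_integral_filter_of_dominated_convergence _ ?_ ?_
      (integrableOn_min_mul_cauchyIntensity ‖z‖ (norm_nonneg _)) ?_
    · exact Eventually.of_forall fun k =>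
        ((((measurable_invSqrtOneAdd z).comp (hmono k)).sub_const 1).mul
          (Complex.measurable_ofReal.comp measurable_cauchyIntensity)).aestronglyMeasurable
    · refine Eventually.of_forall fun k => ?_
      filter_upwards [ae_restrict_mem measurableSet_Ioi] with x hx
      have hx : 0 < x := hx
      rw [norm_mul, Complex.norm_real, Real.norm_of_nonneg (cauchyIntensity_nonneg hx.le)]
      exact mul_le_mul_of_nonneg_right (norm_invSqrtOneAdd_sub_one_le hz (gridPoint_nonneg _ _)
        (gridPoint_gridIndex_le k hx.le)) (cauchyIntensity_nonneg hx.le)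
    · filter_upwards [ae_restrict_mem measurableSet_Ioi] with x hx
      have hx : 0 < x := hx
      have hc := (continuousOn_invSqrtOneAdd hz x hx.le).tendsto.comp
        (tendsto_nhdsWithin_iff.mpr ⟨tendsto_gridPoint_gridIndex hx.le,
          Eventually.of_forall fun k => gridPoint_nonneg _ _⟩)
      exact (hc.sub_const 1).mul_const _
  simp_rw [h.integral_invSqrtDet_grid hz] at h1
  rw [← integral_invSqrtOneAdd hz]
  exact tendsto_nhds_unique h1 ((Complex.continuous_exp.tendsto _).comp h2)

end IsPoissonPointProcess

/-! ### The Cauchy distribution -/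

theorem integral_cauchyMeasure (f : ℝ → ℂ) :
    ∫ x, f x ∂(cauchyMeasure 0 1) = ∫ x : ℝ, ((Real.pi * (1 + x ^ 2))⁻¹ : ℝ) * f x := by
  rw [cauchyMeasure_of_scale_ne_zero 0 one_ne_zero, integral_withDensity_eq_integral_toReal_smul
    (measurable_cauchyPDF 0 1) (ae_of_all _ fun x => by simp [cauchyPDF])]
  refine integral_congr_ae (ae_of_all _ fun x => ?_)
  have h : cauchyPDFReal 0 1 x = (Real.pi * (1 + x ^ 2))⁻¹ := by
    simp [cauchyPDFReal_def, add_comm, mul_comm]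
  have h0 : 0 ≤ cauchyPDFReal 0 1 x := by rw [h]; have := Real.pi_pos; positivity
  beta_reduce
  rw [cauchyPDF_def, ENNReal.toReal_ofReal h0, h, Complex.real_smul]

theorem integrable_exp_neg_two_pi_abs :
    Integrable fun v : ℝ => ((Real.exp (-(2 * Real.pi * |v|)) : ℝ) : ℂ) := by
  refine Integrable.ofReal (f := fun v : ℝ => Real.exp (-(2 * Real.pi * |v|))) ?_
  -- A non-integrable function would have Bochner integral 0, so computing a nonzero value suffices.
  refine Integrable.of_integral_ne_zero ?_
  have hpi := Real.pi_pos
  rw [integral_comp_abs (f := fun v => Real.exp (-(2 * Real.pi * v)))]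
  simp_rw [← neg_mul]
  rw [integral_exp_mul_Ioi (by linarith)]
  simp [hpi.ne']

theorem fourier_exp_neg_two_pi_abs (w : ℝ) :
    FourierTransform.fourier (fun v : ℝ => ((Real.exp (-(2 * Real.pi * |v|)) : ℝ) : ℂ)) w =
      (((Real.pi * (1 + w ^ 2))⁻¹ : ℝ) : ℂ) := by
  have hpi := Real.pi_pos
  have hpc : (Real.pi : ℂ) ≠ 0 := Complex.ofReal_ne_zero.mpr hpi.ne'
  rw [Real.fourier_eq']
  have hint : Integrable fun v : ℝ => Complex.exp (((-2 * Real.pi * inner ℝ v w : ℝ) : ℂ) *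
      Complex.I) • ((Real.exp (-(2 * Real.pi * |v|)) : ℝ) : ℂ) := by
    refine integrable_exp_neg_two_pi_abs.mono (by fun_prop) (ae_of_all _ fun v => ?_)
    rw [norm_smul, Complex.norm_exp_ofReal_mul_I, one_mul]
  rw [← intervalIntegral.integral_Iic_add_Ioi (b := 0) hint.integrableOn hint.integrableOn]
  have e1 : ∫ v : ℝ in Set.Iic 0, Complex.exp (((-2 * Real.pi * inner ℝ v w : ℝ) : ℂ) *
      Complex.I) • ((Real.exp (-(2 * Real.pi * |v|)) : ℝ) : ℂ) =
      1 / (2 * Real.pi * (1 - w * Complex.I)) := by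
    rw [setIntegral_congr_fun (g := fun v : ℝ => Complex.exp ((2 * Real.pi * (1 - w * Complex.I)) *
      (v : ℂ))) measurableSet_Iic, integral_exp_mul_complex_Iic]
    · simp
    · simp [hpi]
    · intro v hv
      have hv : v ≤ 0 := hv
      simp only [abs_of_nonpos hv, smul_eq_mul, Complex.ofReal_exp, ← Complex.exp_add]
      congr 1
      simp
      ring
  have e2 : ∫ v : ℝ in Set.Ioi 0, Complex.exp (((-2 * Real.pi * inner ℝ v w : ℝ) : ℂ) *
      Complex.I) • ((Real.exp (-(2 * Real.pi * |v|)) : ℝ) : ℂ) =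
      1 / (2 * Real.pi * (1 + w * Complex.I)) := by
    rw [setIntegral_congr_fun (g := fun v : ℝ => Complex.exp ((-(2 * Real.pi * (1 + w * Complex.I))) *
      (v : ℂ))) measurableSet_Ioi, integral_exp_mul_complex_Ioi]
    · simp
    · simp [hpi]
    · intro v hv
      have hv : 0 < v := hv
      simp only [abs_of_pos hv, smul_eq_mul, Complex.ofReal_exp, ← Complex.exp_add]
      congr 1
      simp
      ring
  rw [e1, e2]
  have n1 : (1 - w * Complex.I : ℂ) ≠ 0 := fun h => by simpa using congrArg Complex.re h
  have n2 : (1 + w * Complex.I : ℂ) ≠ 0 := fun h => by simpa using congrArg Complex.re h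
  have n3 : (1 + (w : ℂ) ^ 2) = (1 - w * Complex.I) * (1 + w * Complex.I) := by
    ring_nf; simp
  push_cast
  rw [n3]
  field_simp
  ring

/-- Fourier inversion: the Cauchy density is the transform of `exp(-2π|v|)`, which splits at 0 into
two elementary integrals. -/
theorem charFun_cauchyMeasure (t : ℝ) :
    charFun (cauchyMeasure 0 1) t = Complex.exp (-(|t| : ℝ)) := by
  have hpi := Real.pi_pos
  have hcont : Continuous fun v : ℝ => ((Real.exp (-(2 * Real.pi * |v|)) : ℝ) : ℂ) := by fun_prop
  have hF : FourierTransform.fourier (fun v : ℝ => ((Real.exp (-(2 * Real.pi * |v|)) : ℝ) : ℂ)) =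
      fun w => (((Real.pi * (1 + w ^ 2))⁻¹ : ℝ) : ℂ) := funext fourier_exp_neg_two_pi_abs
  have hint : Integrable fun w : ℝ => (((Real.pi * (1 + w ^ 2))⁻¹ : ℝ) : ℂ) := by
    refine Integrable.ofReal (f := fun w : ℝ => (Real.pi * (1 + w ^ 2))⁻¹) ?_
    simp_rw [mul_inv]
    exact integrable_inv_one_add_sq.const_mul _
  have h := congrFun (hcont.fourierInv_fourier_eq integrable_exp_neg_two_pi_abs
    (by rw [hF]; exact hint)) (t / (2 * Real.pi))
  rw [hF, Real.fourierInv_eq'] at h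
  rw [charFun_apply_real, integral_cauchyMeasure]
  have e : Complex.exp (-(|t| : ℝ)) =
      ((Real.exp (-(2 * Real.pi * |t / (2 * Real.pi)|)) : ℝ) : ℂ) := by
    rw [abs_div, abs_of_pos (show 0 < 2 * Real.pi by positivity), mul_div_cancel₀ _ (by positivity)]
    simp
  rw [e, ← h]
  refine integral_congr_ae (ae_of_all _ fun x => ?_)
  have hin : t * x = 2 * Real.pi * inner ℝ x (t / (2 * Real.pi)) := by
    have : inner ℝ x (t / (2 * Real.pi)) = t / (2 * Real.pi) * x := by simp [inner]
    rw [this]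
    field_simp
  beta_reduce
  rw [smul_eq_mul, ← Complex.ofReal_mul t x, hin, mul_comm]

/-- A linear combination of independent standard Cauchy variables. -/
theorem map_sum_mul_pi_cauchyMeasure {n : ℕ} (g : Fin n → ℝ) :
    (Measure.pi fun _ : Fin n => cauchyMeasure 0 1).map (fun a => ∑ k, a k * g k) =
      (cauchyMeasure 0 1).map (fun x => (∑ k, |g k|) * x) := by
  have hmap : ∀ k, (Measure.pi fun _ : Fin n => cauchyMeasure 0 1).map (fun a => a k * g k) =
      (cauchyMeasure 0 1).map (fun x => g k * x) := by
    intro k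
    have h1 : (fun a : Fin n → ℝ => a k * g k) = (fun x => g k * x) ∘ Function.eval k := by
      ext a; simp [mul_comm]
    rw [h1, ← Measure.map_map (by fun_prop) (by fun_prop),
      (measurePreserving_eval (fun _ : Fin n => cauchyMeasure 0 1) k).map_eq]
  have : IsProbabilityMeasure ((cauchyMeasure 0 1).map (fun x => (∑ k, |g k|) * x)) :=
    Measure.isProbabilityMeasure_map (by fun_prop)
  have : IsProbabilityMeasure
      ((Measure.pi fun _ : Fin n => cauchyMeasure 0 1).map (fun a => ∑ k, a k * g k)) :=
    Measure.isProbabilityMeasure_map (Measurable.aemeasurable (by fun_prop))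
  -- Both characteristic functions equal `exp(-|t| ∑ |g k|)`.
  refine Measure.ext_of_charFun ?_
  have hind : iIndepFun (fun k (a : Fin n → ℝ) => a k * g k)
      (Measure.pi fun _ : Fin n => cauchyMeasure 0 1) :=
    iIndepFun_pi (X := fun k x => x * g k) (fun k => by fun_prop)
  rw [hind.charFun_map_fun_sum_eq_prod (fun k => Measurable.aemeasurable (by fun_prop))]
  ext t
  simp_rw [Finset.prod_apply, hmap, charFun_map_mul, charFun_cauchyMeasure, ← Complex.exp_sum]
  rw [abs_mul, abs_of_nonneg (Finset.sum_nonneg fun k _ => abs_nonneg (g k)), Finset.sum_mul]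
  simp [abs_mul]

/-- The Laplace transform of the square of a standard Cauchy variable. -/
noncomputable def cauchySqLaplace (w : ℂ) : ℂ :=
  ∫ x, Complex.exp (-w * (x : ℂ) ^ 2) ∂(cauchyMeasure 0 1)

theorem re_neg_mul_sq_nonpos {w : ℂ} (hw : 0 ≤ w.re) (x : ℝ) : (-w * (x : ℂ) ^ 2).re ≤ 0 := by
  rw [← Complex.ofReal_pow, Complex.re_mul_ofReal, Complex.neg_re]
  nlinarith [sq_nonneg x]

theorem norm_cauchySqLaplace_le_one {w : ℂ} (hw : 0 ≤ w.re) : ‖cauchySqLaplace w‖ ≤ 1 := by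
  refine (norm_integral_le_of_norm_le_const (C := 1) (ae_of_all _ fun x => ?_)).trans (by simp)
  rw [Complex.norm_exp]
  exact Real.exp_le_one_iff.mpr (re_neg_mul_sq_nonpos hw x)

/-- The rows are independent, and each row paired with `g` is Cauchy of scale `∑ |g k|`. -/
theorem integral_exp_neg_sq_sum_pi_cauchyMeasure {m n : ℕ} (g : Fin n → ℝ) (w : ℂ) :
    ∫ a : Fin m → Fin n → ℝ, Complex.exp (-w * ((∑ j, (∑ k, a j k * g k) ^ 2 : ℝ) : ℂ))
      ∂(Measure.pi fun _ => Measure.pi fun _ => cauchyMeasure 0 1) =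
      cauchySqLaplace (w * ((∑ k, |g k| : ℝ) : ℂ) ^ 2) ^ m := by
  have e : ∀ a : Fin m → Fin n → ℝ,
      Complex.exp (-w * ((∑ j, (∑ k, a j k * g k) ^ 2 : ℝ) : ℂ)) =
      ∏ j, Complex.exp (-w * ((∑ k, a j k * g k : ℝ) : ℂ) ^ 2) := by
    intro a
    rw [← Complex.exp_sum, ← Finset.mul_sum]
    push_cast; rfl
  simp_rw [e]
  rw [integral_fintype_prod_eq_prod
    (f := fun _ (b : Fin n → ℝ) => Complex.exp (-w * ((∑ k, b k * g k : ℝ) : ℂ) ^ 2)),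
    Finset.prod_const, Finset.card_univ, Fintype.card_fin]
  congr 1
  rw [← integral_map (φ := fun b : Fin n → ℝ => ∑ k, b k * g k)
    (f := fun y : ℝ => Complex.exp (-w * (y : ℂ) ^ 2)) (Measurable.aemeasurable (by fun_prop))
    (by fun_prop), map_sum_mul_pi_cauchyMeasure, integral_map (by fun_prop) (by fun_prop), cauchySqLaplace]
  refine integral_congr_ae (ae_of_all _ fun x => ?_)
  simp only
  congr 1
  push_cast
  ring

/-! ### The Laplace transform of a squared Cauchy variable near 0 -/

theorem integral_eq_two_mul_Ioi_of_even {f : ℝ → ℂ} (hf : Integrable f) (he : ∀ x, f (-x) = f x) :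
    ∫ x, f x = 2 * ∫ x in Set.Ioi 0, f x := by
  rw [← intervalIntegral.integral_Iic_add_Ioi (b := 0) hf.integrableOn hf.integrableOn]
  have h := integral_comp_neg_Ioi 0 f
  simp_rw [he, neg_zero] at h
  rw [← h]
  ring

theorem integrableOn_min_mul_sq_div_sq {C : ℝ} (hC : 0 ≤ C) :
    IntegrableOn (fun y : ℝ => min 2 (C * y ^ 2) / y ^ 2) (Set.Ioi 0) := by
  have hm : Measurable (fun y : ℝ => min 2 (C * y ^ 2) / y ^ 2) :=
    (measurable_const.min (by fun_prop)).div (by fun_prop)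
  have h0 : ∀ y : ℝ, 0 ≤ min 2 (C * y ^ 2) := fun y => le_min (by norm_num) (by positivity)
  rw [← Set.Ioc_union_Ioi_eq_Ioi (zero_le_one (α := ℝ))]
  refine IntegrableOn.union ?_ ?_
  · refine Integrable.mono' (g := fun _ => C) (integrable_const _) hm.aestronglyMeasurable ?_
    filter_upwards [ae_restrict_mem measurableSet_Ioc] with y hy
    have hy0 : 0 < y := hy.1
    rw [norm_div, Real.norm_of_nonneg (h0 y), Real.norm_of_nonneg (by positivity),
      div_le_iff₀ (by positivity)]
    exact min_le_right _ _
  · refine Integrable.mono' ((integrableOn_Ioi_rpow_of_lt (a := -2) (by norm_num)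
      one_pos).const_mul 2) hm.aestronglyMeasurable ?_
    filter_upwards [ae_restrict_mem measurableSet_Ioi] with y hy
    have hy0 : 0 < y := one_pos.trans hy
    rw [norm_div, Real.norm_of_nonneg (h0 y), Real.norm_of_nonneg (by positivity),
      Real.rpow_neg hy0.le, Real.rpow_two, ← div_eq_mul_inv]
    gcongr
    exact min_le_left _ _

theorem norm_exp_neg_mul_sq_sub_one_le {w : ℂ} (hw : 0 ≤ w.re) (y : ℝ) :
    ‖Complex.exp (-w * (y : ℂ) ^ 2) - 1‖ ≤ min 2 (‖w‖ * y ^ 2) := by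
  have h := re_neg_mul_sq_nonpos hw y
  refine le_min (norm_exp_sub_one_le_two h) ((norm_exp_sub_one_le_of_re_nonpos h).trans ?_)
  rw [norm_mul, norm_neg, norm_pow, Complex.norm_real, Real.norm_eq_abs, sq_abs]

theorem integrableOn_exp_neg_mul_sq_sub_one_div {w : ℂ} (hw : 0 ≤ w.re) :
    IntegrableOn (fun y : ℝ => (Complex.exp (-w * (y : ℂ) ^ 2) - 1) / (y : ℂ) ^ 2) (Set.Ioi 0) := by
  refine Integrable.mono' (integrableOn_min_mul_sq_div_sq (norm_nonneg w))
    (Measurable.aestronglyMeasurable (by fun_prop)) (ae_of_all _ fun y => ?_)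
  rw [norm_div, norm_pow, Complex.norm_real, Real.norm_eq_abs, sq_abs]
  exact div_le_div_of_nonneg_right (norm_exp_neg_mul_sq_sub_one_le hw y) (sq_nonneg y)

/-- Integration by parts against `-1/y`: the boundary terms vanish and a Gaussian integral remains.
-/
theorem integral_exp_neg_mul_sq_sub_one_div {w : ℂ} (hw : 0 < w.re) :
    ∫ y in Set.Ioi (0 : ℝ), (Complex.exp (-w * (y : ℂ) ^ 2) - 1) / (y : ℂ) ^ 2 =
      -w * ((Real.pi : ℂ) / w) ^ (1 / 2 : ℂ) := by
  have hi1 := integrableOn_exp_neg_mul_sq_sub_one_div hw.le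
  have hi2 : IntegrableOn (fun y : ℝ => 2 * w * Complex.exp (-w * (y : ℂ) ^ 2)) (Set.Ioi 0) :=
    ((integrable_cexp_neg_mul_sq hw).const_mul _).integrableOn
  have hb : ∀ y : ℝ, 0 < y → ‖-((Complex.exp (-w * (y : ℂ) ^ 2) - 1) / (y : ℂ))‖ ≤
      min 2 (‖w‖ * y ^ 2) / y := fun y hy => by
    rw [norm_neg, norm_div, Complex.norm_real, Real.norm_of_nonneg hy.le]
    exact div_le_div_of_nonneg_right (norm_exp_neg_mul_sq_sub_one_le hw.le y) hy.le
  have hF := integral_Ioi_of_hasDerivAt_of_tendsto (a := 0) (m := 0)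
    (f := fun y : ℝ => -((Complex.exp (-w * (y : ℂ) ^ 2) - 1) / (y : ℂ)))
    (f' := fun y : ℝ => (Complex.exp (-w * (y : ℂ) ^ 2) - 1) / (y : ℂ) ^ 2 +
      2 * w * Complex.exp (-w * (y : ℂ) ^ 2)) ?_ ?_ (hi1.add hi2) ?_
  · rw [integral_add hi1 hi2, integral_const_mul, integral_gaussian_complex_Ioi hw] at hF
    simp only [Complex.ofReal_zero, div_zero, neg_zero, sub_zero] at hF
    linear_combination hF
  -- Division by zero gives the value 0 at `y = 0`, which is also the limit there.
  · rw [ContinuousWithinAt]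
    simp only [Complex.ofReal_zero, div_zero, neg_zero]
    have hlim : Tendsto (fun y : ℝ => ‖w‖ * y) (𝓝[≥] 0) (𝓝 0) := by
      have hc : Continuous fun y : ℝ => ‖w‖ * y := by fun_prop
      have := hc.tendsto 0
      rw [mul_zero] at this
      exact this.mono_left nhdsWithin_le_nhds
    refine squeeze_zero_norm' ?_ hlim
    filter_upwards [self_mem_nhdsWithin] with y hy
    rcases (show (0 : ℝ) ≤ y from hy).eq_or_lt with rfl | hy
    · simp
    refine (hb y hy).trans ?_
    rw [div_le_iff₀ hy]
    exact (min_le_right _ _).trans (by ring_nf; rfl)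
  · intro y hy
    have hy : (y : ℂ) ≠ 0 := Complex.ofReal_ne_zero.mpr (ne_of_gt hy)
    have h1 : HasDerivAt (fun v : ℂ => -((Complex.exp (-w * v ^ 2) - 1) / v))
        (-((Complex.exp (-w * (y : ℂ) ^ 2) * (-w * (2 * (y : ℂ))) * y -
          (Complex.exp (-w * (y : ℂ) ^ 2) - 1) * 1) / (y : ℂ) ^ 2)) (y : ℂ) := by
      have h2 : HasDerivAt (fun v : ℂ => -w * v ^ 2) (-w * (2 * (y : ℂ))) (y : ℂ) := by
        simpa using (hasDerivAt_pow 2 (y : ℂ)).const_mul (-w)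
      exact ((h2.cexp.sub_const 1).div (hasDerivAt_id _) hy).neg
    refine h1.comp_ofReal.congr_deriv ?_
    field_simp
    ring
  · have hlim : Tendsto (fun y : ℝ => 2 * y⁻¹) atTop (𝓝 0) := by
      simpa using (tendsto_inv_atTop_zero (𝕜 := ℝ)).const_mul 2
    refine squeeze_zero_norm' ?_ hlim
    filter_upwards [eventually_gt_atTop 0] with y hy
    refine (hb y hy).trans ?_
    rw [div_eq_mul_inv]
    gcongr
    exact min_le_left _ _

theorem cauchySqLaplace_sub_one {w : ℂ} (hw : 0 ≤ w.re) :
    cauchySqLaplace w - 1 = 2 * ∫ x in Set.Ioi (0 : ℝ),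
      ((Real.pi * (1 + x ^ 2))⁻¹ : ℝ) * (Complex.exp (-w * (x : ℂ) ^ 2) - 1) := by
  have hi : Integrable (fun x : ℝ => Complex.exp (-w * (x : ℂ) ^ 2)) (cauchyMeasure 0 1) := by
    refine Integrable.of_bound (by fun_prop) 1 (ae_of_all _ fun x => ?_)
    rw [Complex.norm_exp]
    exact Real.exp_le_one_iff.mpr (re_neg_mul_sq_nonpos hw x)
  have h1 : cauchySqLaplace w - 1 =
      ∫ x, (Complex.exp (-w * (x : ℂ) ^ 2) - 1) ∂(cauchyMeasure 0 1) := by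
    rw [integral_sub hi (integrable_const _)]
    simp [cauchySqLaplace]
  rw [h1, integral_cauchyMeasure, integral_eq_two_mul_Ioi_of_even]
  · have hd : Integrable (fun x : ℝ => 2 * (Real.pi * (1 + x ^ 2))⁻¹) := by
      simp_rw [mul_inv]
      exact (integrable_inv_one_add_sq.const_mul _).const_mul _
    refine hd.mono' (Measurable.aestronglyMeasurable (by fun_prop)) (ae_of_all _ fun x => ?_)
    have hpi := Real.pi_pos
    rw [norm_mul, Complex.norm_real, Real.norm_of_nonneg (by positivity), mul_comm]
    exact mul_le_mul_of_nonneg_right (norm_exp_sub_one_le_two (re_neg_mul_sq_nonpos hw x))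
      (by positivity)
  · intro x; simp

/-- The substitution `x = m y` moves all dependence on `m` into the kernel `1 / (π (m⁻² + y²))`,
which increases to `1 / (π y²)`. -/
theorem natCast_mul_cauchySqLaplace_sub_one {m : ℕ} (hm : 0 < m) {ζ : ℂ} (hζ : 0 ≤ ζ.re) :
    (m : ℂ) * (cauchySqLaplace (ζ / (m : ℂ) ^ 2) - 1) = 2 * ∫ y in Set.Ioi (0 : ℝ),
      ((Real.pi * ((m : ℝ)⁻¹ ^ 2 + y ^ 2))⁻¹ : ℝ) * (Complex.exp (-ζ * (y : ℂ) ^ 2) - 1) := by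
  have hm' : (0 : ℝ) < m := by exact_mod_cast hm
  have hmc : (m : ℂ) ≠ 0 := by exact_mod_cast hm.ne'
  have hre : 0 ≤ (ζ / (m : ℂ) ^ 2).re := by
    have : (m : ℂ) ^ 2 = (((m : ℝ) ^ 2 : ℝ) : ℂ) := by push_cast; rfl
    rw [this, Complex.div_ofReal_re]
    positivity
  rw [cauchySqLaplace_sub_one hre]
  have h := integral_comp_mul_left_Ioi (fun x : ℝ => (((Real.pi * (1 + x ^ 2))⁻¹ : ℝ) : ℂ) *
    (Complex.exp (-(ζ / (m : ℂ) ^ 2) * (x : ℂ) ^ 2) - 1)) 0 hm'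
  rw [mul_zero] at h
  have h2 : ∫ x in Set.Ioi (0 : ℝ), (((Real.pi * (1 + x ^ 2))⁻¹ : ℝ) : ℂ) *
      (Complex.exp (-(ζ / (m : ℂ) ^ 2) * (x : ℂ) ^ 2) - 1) = (m : ℂ) *
      ∫ y in Set.Ioi (0 : ℝ), (((Real.pi * (1 + (m * y) ^ 2))⁻¹ : ℝ) : ℂ) *
      (Complex.exp (-(ζ / (m : ℂ) ^ 2) * ((m * y : ℝ) : ℂ) ^ 2) - 1) := by
    rw [h, Complex.real_smul]
    push_cast
    rw [mul_inv_cancel_left₀ hmc]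
  rw [h2, mul_left_comm, ← integral_const_mul, ← integral_const_mul]
  congr 1
  refine integral_congr_ae (ae_of_all _ fun y => ?_)
  beta_reduce
  have e1 : -(ζ / (m : ℂ) ^ 2) * ((m * y : ℝ) : ℂ) ^ 2 = -ζ * (y : ℂ) ^ 2 := by
    push_cast; field_simp
  have e2 : (Real.pi * ((m : ℝ)⁻¹ ^ 2 + y ^ 2))⁻¹ = m * (m * (Real.pi * (1 + (m * y) ^ 2))⁻¹) := by
    have hpi := Real.pi_ne_zero
    field_simp
  rw [e1, e2]
  push_cast
  ring

theorem tendsto_natCast_mul_cauchySqLaplace_sub_one {m : ℕ → ℕ} (hm : Tendsto m atTop atTop)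
    {ζ : ℕ → ℂ} {ζ₀ : ℂ} (hζ : ∀ n, 0 ≤ (ζ n).re) (hζ₀ : 0 < ζ₀.re)
    (hlim : Tendsto ζ atTop (𝓝 ζ₀)) :
    Tendsto (fun n => (m n : ℂ) * (cauchySqLaplace (ζ n / (m n : ℂ) ^ 2) - 1)) atTop
      (𝓝 (-(2 / (Real.pi : ℂ)) * (ζ₀ * ((Real.pi : ℂ) / ζ₀) ^ (1 / 2 : ℂ)))) := by
  have hpi := Real.pi_pos
  have hpc : (Real.pi : ℂ) ≠ 0 := Complex.ofReal_ne_zero.mpr hpi.ne'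
  have hval : -(2 / (Real.pi : ℂ)) * (ζ₀ * ((Real.pi : ℂ) / ζ₀) ^ (1 / 2 : ℂ)) =
      2 * ∫ y in Set.Ioi (0 : ℝ), ((Real.pi * y ^ 2)⁻¹ : ℝ) *
        (Complex.exp (-ζ₀ * (y : ℂ) ^ 2) - 1) := by
    have e : ∀ y : ℝ, (((Real.pi * y ^ 2)⁻¹ : ℝ) : ℂ) * (Complex.exp (-ζ₀ * (y : ℂ) ^ 2) - 1) =
        (Real.pi : ℂ)⁻¹ * ((Complex.exp (-ζ₀ * (y : ℂ) ^ 2) - 1) / (y : ℂ) ^ 2) := by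
      intro y; push_cast; rw [mul_inv]; ring
    simp_rw [e]
    rw [integral_const_mul, integral_exp_neg_mul_sq_sub_one_div hζ₀]
    ring
  rw [hval]
  have hmain : Tendsto (fun n => 2 * ∫ y in Set.Ioi (0 : ℝ),
      (((Real.pi * ((m n : ℝ)⁻¹ ^ 2 + y ^ 2))⁻¹ : ℝ) : ℂ) *
        (Complex.exp (-ζ n * (y : ℂ) ^ 2) - 1)) atTop
      (𝓝 (2 * ∫ y in Set.Ioi (0 : ℝ), ((Real.pi * y ^ 2)⁻¹ : ℝ) *
        (Complex.exp (-ζ₀ * (y : ℂ) ^ 2) - 1))) := by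
    refine Tendsto.const_mul _ (tendsto_integral_filter_of_dominated_convergence
      (fun y => Real.pi⁻¹ * (min 2 ((‖ζ₀‖ + 1) * y ^ 2) / y ^ 2)) ?_ ?_
      ((integrableOn_min_mul_sq_div_sq (by positivity)).const_mul _) ?_)
    · exact Eventually.of_forall fun n => Measurable.aestronglyMeasurable (by fun_prop)
    -- Eventually `‖ζ n‖ < ‖ζ₀‖ + 1`, which gives a dominating function independent of `n`.
    · filter_upwards [hlim.norm.eventually_lt_const (lt_add_one ‖ζ₀‖)] with n hn
      filter_upwards [ae_restrict_mem measurableSet_Ioi] with y hy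
      have hy : 0 < y := hy
      rw [norm_mul, Complex.norm_real, Real.norm_of_nonneg (by positivity)]
      have h1 : ‖Complex.exp (-ζ n * (y : ℂ) ^ 2) - 1‖ ≤ min 2 ((‖ζ₀‖ + 1) * y ^ 2) :=
        (norm_exp_neg_mul_sq_sub_one_le (hζ n) y).trans (min_le_min_left _ (by gcongr))
      have h2 : (Real.pi * ((m n : ℝ)⁻¹ ^ 2 + y ^ 2))⁻¹ ≤ (Real.pi * y ^ 2)⁻¹ := by
        gcongr
        exact le_add_of_nonneg_left (by positivity)
      calc _ ≤ (Real.pi * y ^ 2)⁻¹ * min 2 ((‖ζ₀‖ + 1) * y ^ 2) :=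
            mul_le_mul h2 h1 (norm_nonneg _) (by positivity)
        _ = _ := by rw [mul_inv]; ring
    · filter_upwards [ae_restrict_mem measurableSet_Ioi] with y hy
      have hy : 0 < y := hy
      refine Tendsto.mul ?_ ?_
      · refine (Complex.continuous_ofReal.tendsto _).comp (Tendsto.inv₀ (Tendsto.const_mul _ ?_)
          (by positivity))
        have : Tendsto (fun n => ((m n : ℝ))⁻¹) atTop (𝓝 0) :=
          tendsto_inv_atTop_zero.comp (tendsto_natCast_atTop_atTop.comp hm)
        simpa using (this.pow 2).add_const (y ^ 2)
      · exact ((Complex.continuous_exp.tendsto _).comp ((hlim.neg).mul_const _)).sub_const 1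
  refine hmain.congr' ?_
  filter_upwards [hm.eventually_gt_atTop 0] with n hn
  exact (natCast_mul_cauchySqLaplace_sub_one hn (hζ n)).symm

/-- Since `g → 0`, `m log(1 + g)` is `m g` times a difference quotient of `log` at 1, which tends to
1. Using `dslope` covers `g = 0` as well. -/
theorem tendsto_one_add_pow_exp_of_tendsto_mul {m : ℕ → ℕ} (hm : Tendsto m atTop atTop)
    {g : ℕ → ℂ} {L : ℂ} (hg : Tendsto (fun n => (m n : ℂ) * g n) atTop (𝓝 L)) :
    Tendsto (fun n => (1 + g n) ^ m n) atTop (𝓝 (Complex.exp L)) := by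
  have hg0 : Tendsto g atTop (𝓝 0) := by
    have h1 : Tendsto (fun n => ((m n : ℂ))⁻¹) atTop (𝓝 0) :=
      (tendsto_inv_atTop_nhds_zero_nat (𝕜 := ℂ)).comp hm
    have h2 := h1.mul hg
    rw [zero_mul] at h2
    refine h2.congr' ?_
    filter_upwards [hm.eventually_gt_atTop 0] with n hn
    rw [inv_mul_cancel_left₀ (by exact_mod_cast hn.ne')]
  have hg1 : Tendsto (fun n => 1 + g n) atTop (𝓝 1) := by simpa using hg0.const_add 1
  have hd : DifferentiableAt ℂ Complex.log 1 := Complex.differentiableAt_log (by simp)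
  have h3 : Tendsto (fun n => dslope Complex.log 1 (1 + g n)) atTop (𝓝 1) := by
    have := (continuousAt_dslope_same.mpr hd).tendsto.comp hg1
    rwa [dslope_same, (Complex.hasDerivAt_log (by simp : (1 : ℂ) ∈ Complex.slitPlane)).deriv,
      inv_one] at this
  have h4 := (hg.mul h3)
  rw [mul_one] at h4
  refine ((Complex.continuous_exp.tendsto _).comp h4).congr' ?_
  filter_upwards [hg1.eventually_ne one_ne_zero] with n hn
  have h5 := sub_smul_dslope Complex.log 1 (1 + g n)
  rw [Complex.log_one, sub_zero, add_sub_cancel_left, smul_eq_mul] at h5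
  rw [Function.comp_apply, mul_assoc, h5, Complex.exp_nat_mul, Complex.exp_log hn]

theorem tendsto_cauchySqLaplace_pow {m : ℕ → ℕ} (hm : Tendsto m atTop atTop)
    {ζ : ℕ → ℂ} {ζ₀ : ℂ} (hζ : ∀ n, 0 ≤ (ζ n).re) (hζ₀ : 0 < ζ₀.re)
    (hlim : Tendsto ζ atTop (𝓝 ζ₀)) :
    Tendsto (fun n => cauchySqLaplace (ζ n / (m n : ℂ) ^ 2) ^ m n) atTop
      (𝓝 (Complex.exp (-(2 / (Real.pi : ℂ)) * (ζ₀ * ((Real.pi : ℂ) / ζ₀) ^ (1 / 2 : ℂ))))) := by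
  have h := tendsto_one_add_pow_exp_of_tendsto_mul hm
    (tendsto_natCast_mul_cauchySqLaplace_sub_one hm hζ hζ₀ hlim)
  simpa using h

/-! ### Determinants as Gaussian integrals -/

theorem integral_exp_neg_half_mul_sq_gaussianReal {z : ℂ} (hz : 0 < z.re) {y : ℝ} (hy : 0 ≤ y) :
    ∫ x, Complex.exp (-(z / 2) * ((y * x ^ 2 : ℝ) : ℂ)) ∂(gaussianReal 0 1) =
      invSqrtOneAdd z y := by
  have hpi := Real.pi_pos
  rw [integral_gaussianReal_eq_integral_smul one_ne_zero]
  have hs := one_add_mem_slitPlane (re_mul_ofReal_nonneg hy hz)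
  have hne := Complex.slitPlane_ne_zero hs
  have hb : 0 < ((1 + z * (y : ℂ)) / 2).re := by
    have := re_mul_ofReal_nonneg hy hz
    rw [show (2 : ℂ) = ((2 : ℝ) : ℂ) by norm_num, Complex.div_ofReal_re, Complex.add_re,
      Complex.one_re]
    positivity
  have e : ∀ x : ℝ, gaussianPDFReal 0 1 x • Complex.exp (-(z / 2) * ((y * x ^ 2 : ℝ) : ℂ)) =
      (((Real.sqrt (2 * Real.pi))⁻¹ : ℝ) : ℂ) *
        Complex.exp (-((1 + z * (y : ℂ)) / 2) * (x : ℂ) ^ 2) := by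
    intro x
    rw [gaussianPDFReal, Complex.real_smul]
    push_cast
    rw [mul_assoc, ← Complex.exp_add]
    congr 2
    · simp
    · simp; ring
  simp_rw [e]
  rw [integral_const_mul, integral_gaussian_complex hb]
  have e2 : (Real.pi : ℂ) / ((1 + z * (y : ℂ)) / 2) =
      ((2 * Real.pi : ℝ) : ℂ) * (1 + z * (y : ℂ))⁻¹ := by
    push_cast; field_simp
  have e3 : (((Real.sqrt (2 * Real.pi))⁻¹ : ℝ) : ℂ) =
      Complex.exp (-((1 / 2) * (Real.log (2 * Real.pi) : ℂ))) := by
    rw [Real.sqrt_eq_rpow, Real.rpow_def_of_pos (by positivity), ← Real.exp_neg]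
    push_cast
    ring_nf
  -- The principal logarithm splits here because one factor is a positive real and `1 + z y` lies
  -- off the negative axis.
  rw [e2, Complex.cpow_def_of_ne_zero (mul_ne_zero (Complex.ofReal_ne_zero.mpr (by positivity))
    (inv_ne_zero hne)), Complex.log_ofReal_mul (by positivity) (inv_ne_zero hne),
    Complex.log_inv _ (Complex.slitPlane_arg_ne_pi hs), e3, ← Complex.exp_add, invSqrtOneAdd]
  congr 1
  ring

theorem sum_mulVec_sq_eigenvectorBasis {m n : ℕ} (A : Matrix (Fin m) (Fin n) ℝ) (x : Fin n → ℝ) :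
    ∑ j, (∑ k, A j k * (∑ i, x i •
      (isHermitian_transpose_mul_self_real A).eigenvectorBasis i).ofLp k) ^ 2 =
      ∑ i, (isHermitian_transpose_mul_self_real A).eigenvalues i * x i ^ 2 := by
  set hA := isHermitian_transpose_mul_self_real A
  set v := ∑ i, x i • hA.eigenvectorBasis i with hv
  have h1 : ∑ j, (∑ k, A j k * v.ofLp k) ^ 2 = v.ofLp ⬝ᵥ ((Aᵀ * A) *ᵥ v.ofLp) := by
    rw [← Matrix.mulVec_mulVec, Matrix.dotProduct_mulVec, Matrix.vecMul_transpose]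
    simp only [dotProduct, Matrix.mulVec, sq]
  have h2 : (Aᵀ * A) *ᵥ v.ofLp =
      (∑ i, (hA.eigenvalues i * x i) • hA.eigenvectorBasis i).ofLp := by
    have : v.ofLp = ∑ i, x i • (hA.eigenvectorBasis i).ofLp := by rw [hv]; simp
    rw [this, Matrix.mulVec_sum]
    simp only [WithLp.ofLp_sum, WithLp.ofLp_smul]
    refine Finset.sum_congr rfl fun i _ => ?_
    rw [Matrix.mulVec_smul, hA.mulVec_eigenvectorBasis, smul_smul, mul_comm]
  have h3 := hA.eigenvectorBasis.orthonormal.inner_sum x (fun i => hA.eigenvalues i * x i)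
    Finset.univ
  rw [h1, h2]
  rw [← hv, EuclideanSpace.inner_eq_star_dotProduct, dotProduct_comm] at h3
  simp only [star_trivial, conj_trivial] at h3
  rw [h3]
  exact Finset.sum_congr rfl fun i _ => by ring

theorem rescaledEigenvalue_nonneg {m n : ℕ} (A : Matrix (Fin m) (Fin n) ℝ) (i : Fin n) :
    0 ≤ rescaledEigenvalue A i := by
  have h : (Aᵀ * A).PosSemidef := by
    have := Matrix.posSemidef_conjTranspose_mul_self A
    rwa [Matrix.conjTranspose_eq_transpose_of_trivial] at this
  exact div_nonneg (h.eigenvalues_nonneg i) (by positivity)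

/-- The exponent whose Gaussian average is `∏ (1 + z λ_i / (n² m²)) ^ (-1/2)`. -/
noncomputable def quadExp {m n : ℕ} (z : ℂ) (a : Fin m → Fin n → ℝ) (g : Fin n → ℝ) : ℂ :=
  Complex.exp (-(z / (2 * ((n : ℂ) ^ 2 * (m : ℂ) ^ 2))) * ((∑ j, (∑ k, a j k * g k) ^ 2 : ℝ) : ℂ))

theorem measurable_quadExp {m n : ℕ} (z : ℂ) :
    Measurable fun p : (Fin m → Fin n → ℝ) × (Fin n → ℝ) => quadExp z p.1 p.2 := by
  unfold quadExp
  fun_prop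

theorem norm_quadExp_le_one {m n : ℕ} {z : ℂ} (hz : 0 < z.re) (a : Fin m → Fin n → ℝ)
    (g : Fin n → ℝ) : ‖quadExp z a g‖ ≤ 1 := by
  rw [quadExp, Complex.norm_exp, Real.exp_le_one_iff, Complex.re_mul_ofReal, Complex.neg_re]
  have h1 : (2 * ((n : ℂ) ^ 2 * (m : ℂ) ^ 2)) = ((2 * ((n : ℝ) ^ 2 * (m : ℝ) ^ 2) : ℝ) : ℂ) := by
    push_cast; rfl
  have h2 : 0 ≤ (z / (2 * ((n : ℂ) ^ 2 * (m : ℂ) ^ 2))).re := by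
    rw [h1, Complex.div_ofReal_re]; positivity
  have h3 : 0 ≤ ∑ j, (∑ k, a j k * g k) ^ 2 := Finset.sum_nonneg fun j _ => sq_nonneg _
  nlinarith

/-- The standard Gaussian has independent standard coordinates in the eigenbasis of `AᵗA`, so the
integral factors into one-dimensional Gaussian integrals. -/
theorem integral_quadExp_gaussian {m n : ℕ} (a : Fin m → Fin n → ℝ) {z : ℂ}
    (hz : 0 < z.re) : ∫ g, quadExp z a g ∂(Measure.pi fun _ : Fin n => gaussianReal 0 1) =
      invSqrtDet (rescaledEigenvalue (Matrix.of a)) z := by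
  set A : Matrix (Fin m) (Fin n) ℝ := Matrix.of a with hAdef
  have hA := isHermitian_transpose_mul_self_real A
  have hmeas : Measurable fun v : EuclideanSpace ℝ (Fin n) => quadExp z a v.ofLp :=
    by unfold quadExp; fun_prop
  have h1 : ∫ g, quadExp z a g ∂(Measure.pi fun _ : Fin n => gaussianReal 0 1) =
      ∫ v, quadExp z a v.ofLp ∂(stdGaussian (EuclideanSpace ℝ (Fin n))) := by
    rw [← map_pi_eq_stdGaussian, integral_map (by fun_prop) hmeas.aestronglyMeasurable]
  rw [h1, stdGaussian_eq_map_pi_orthonormalBasis hA.eigenvectorBasis,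
    integral_map (Measurable.aemeasurable (by fun_prop)) hmeas.aestronglyMeasurable]
  have h2 : ∀ x : Fin n → ℝ, quadExp z a (∑ i, x i • hA.eigenvectorBasis i).ofLp =
      ∏ i, Complex.exp (-(z / 2) * ((rescaledEigenvalue A i * x i ^ 2 : ℝ) : ℂ)) := by
    intro x
    have hsum := sum_mulVec_sq_eigenvectorBasis A x
    simp only [hAdef, Matrix.of_apply] at hsum
    rw [quadExp, hsum, ← Complex.exp_sum, ← Finset.mul_sum,
      ← Complex.ofReal_sum]
    congr 1
    have : ∑ i, rescaledEigenvalue A i * x i ^ 2 = (∑ i, hA.eigenvalues i * x i ^ 2) /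
        ((n : ℝ) ^ 2 * (m : ℝ) ^ 2) := by
      rw [Finset.sum_div]
      exact Finset.sum_congr rfl fun i _ => by rw [rescaledEigenvalue]; ring
    rw [this]
    push_cast
    rw [← div_div]
    ring
  simp_rw [h2]
  rw [integral_fintype_prod_eq_prod
    (f := fun i (x : ℝ) => Complex.exp (-(z / 2) * ((rescaledEigenvalue A i * x ^ 2 : ℝ) : ℂ)))]
  simp_rw [fun i => integral_exp_neg_half_mul_sq_gaussianReal hz (rescaledEigenvalue_nonneg A i)]
  exact (hasProd_fintype _).unique (hasProd_invSqrtOneAdd (rescaledEigenvalue_nonneg A)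
    Summable.of_finite hz)

theorem integral_abs_gaussianReal :
    ∫ x, |x| ∂(gaussianReal 0 1) = 2 / Real.sqrt (2 * Real.pi) := by
  rw [integral_gaussianReal_eq_integral_smul one_ne_zero]
  have e : ∀ x : ℝ, gaussianPDFReal 0 1 x • |x| =
      (Real.sqrt (2 * Real.pi))⁻¹ * (|x| ^ (1 : ℝ) * Real.exp (-(1 / 2) * |x| ^ (2 : ℝ))) := by
    intro x
    rw [gaussianPDFReal, Real.rpow_two, sq_abs, Real.rpow_one]
    simp only [sub_zero, NNReal.coe_one, mul_one, smul_eq_mul]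
    ring_nf
  simp_rw [e]
  rw [integral_const_mul,
    integral_comp_abs (f := fun x => x ^ (1 : ℝ) * Real.exp (-(1 / 2) * x ^ (2 : ℝ))),
    integral_rpow_mul_exp_neg_mul_rpow (by norm_num) (by norm_num) (by norm_num)]
  norm_num
  ring

/-! ### The random matrix side -/

theorem measurable_cauchySqLaplace : Measurable cauchySqLaplace := by
  have h : Measurable fun p : ℂ × ℝ => Complex.exp (-p.1 * (p.2 : ℂ) ^ 2) := by fun_prop
  exact h.stronglyMeasurable.integral_prod_right.measurable

namespace IsCauchyMatrix

variable {Ω : Type*} [MeasurableSpace Ω] {m n : ℕ} {P : Measure Ω}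
  {A : Ω → Matrix (Fin m) (Fin n) ℝ}

theorem aemeasurable (hA : IsCauchyMatrix P A) :
    AEMeasurable (fun ω j k => A ω j k) P :=
  aemeasurable_pi_lambda _ fun j => aemeasurable_pi_lambda _ fun k => (hA.entry_law j k).aemeasurable

theorem map_eq [IsProbabilityMeasure P] (hA : IsCauchyMatrix P A) :
    P.map (fun ω j k => A ω j k) =
      Measure.pi fun _ => Measure.pi fun _ => cauchyMeasure 0 1 := by
  have hm : ∀ p : Fin m × Fin n, AEMeasurable (fun ω => A ω p.1 p.2) P :=
    fun p => (hA.entry_law p.1 p.2).aemeasurable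
  have h1 := (iIndepFun_iff_map_fun_eq_pi_map hm).mp hA.indep
  simp_rw [fun p : Fin m × Fin n => (hA.entry_law p.1 p.2).map_eq] at h1
  have h2 : (fun ω j k => A ω j k) =
      MeasurableEquiv.curry (Fin m) (Fin n) ℝ ∘ fun ω (p : Fin m × Fin n) => A ω p.1 p.2 := rfl
  rw [h2, ← AEMeasurable.map_map_of_aemeasurable (MeasurableEquiv.measurable _).aemeasurable
    (aemeasurable_pi_lambda _ hm), h1, ← Measure.infinitePi_eq_pi,
    Measure.infinitePi_map_curry (fun _ _ => cauchyMeasure 0 1), Measure.infinitePi_eq_pi]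
  simp_rw [Measure.infinitePi_eq_pi]

/-- The Gaussian representation gives measurability in `A` without any measurability of single
eigenvalues. -/
theorem aestronglyMeasurable_invSqrtDet (hA : IsCauchyMatrix P A) {z : ℂ} (hz : 0 < z.re) :
    AEStronglyMeasurable (fun ω => invSqrtDet (rescaledEigenvalue (A ω)) z) P := by
  have hrep : ∀ ω, invSqrtDet (rescaledEigenvalue (A ω)) z =
      ∫ g, quadExp z (fun j k => A ω j k) g ∂(Measure.pi fun _ : Fin n => gaussianReal 0 1) :=
    fun ω => (integral_quadExp_gaussian (fun j k => A ω j k) hz).symm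
  simp_rw [hrep]
  have h : StronglyMeasurable fun a : Fin m → Fin n → ℝ =>
      ∫ g, quadExp z a g ∂(Measure.pi fun _ : Fin n => gaussianReal 0 1) :=
    (measurable_quadExp z).stronglyMeasurable.integral_prod_right
  exact h.aestronglyMeasurable.comp_aemeasurable hA.aemeasurable

/-- Fubini, legitimate since the exponential is bounded by 1: the Cauchy entries are integrated
first with `g` frozen. -/
theorem integral_invSqrtDet [IsProbabilityMeasure P] (hA : IsCauchyMatrix P A) {z : ℂ} (hz : 0 < z.re) :
    ∫ ω, invSqrtDet (rescaledEigenvalue (A ω)) z ∂P =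
      ∫ g, cauchySqLaplace (z * (((∑ k, |g k|) / n : ℝ) : ℂ) ^ 2 / 2 / (m : ℂ) ^ 2) ^ m
        ∂(Measure.pi fun _ : Fin n => gaussianReal 0 1) := by
  have h : StronglyMeasurable fun a : Fin m → Fin n → ℝ =>
      ∫ g, quadExp z a g ∂(Measure.pi fun _ : Fin n => gaussianReal 0 1) :=
    (measurable_quadExp z).stronglyMeasurable.integral_prod_right
  have hrep : ∀ ω, invSqrtDet (rescaledEigenvalue (A ω)) z =
      ∫ g, quadExp z (fun j k => A ω j k) g ∂(Measure.pi fun _ : Fin n => gaussianReal 0 1) :=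
    fun ω => (integral_quadExp_gaussian (fun j k => A ω j k) hz).symm
  simp_rw [hrep]
  rw [← integral_map (f := fun a : Fin m → Fin n → ℝ =>
      ∫ g, quadExp z a g ∂(Measure.pi fun _ : Fin n => gaussianReal 0 1)) hA.aemeasurable
    h.aestronglyMeasurable, hA.map_eq, integral_integral_swap]
  · refine integral_congr_ae (ae_of_all _ fun g => ?_)
    simp only [quadExp]
    rw [integral_exp_neg_sq_sum_pi_cauchyMeasure]
    congr 2
    push_cast
    rw [div_pow, ← div_div, ← div_div]
    ring
  · refine Integrable.of_bound (measurable_quadExp z).aestronglyMeasurable 1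
      (ae_of_all _ fun p => norm_quadExp_le_one hz _ _)

end IsCauchyMatrix

theorem tendsto_integral_invSqrtDet {Ω : ℕ → Type*} [∀ n, MeasurableSpace (Ω n)]
    (P : ∀ n, Measure (Ω n)) [∀ n, IsProbabilityMeasure (P n)]
    (m : ℕ → ℕ) (hm : ∀ n, n ≤ m n)
    (A : ∀ n, Ω n → Matrix (Fin (m n)) (Fin n) ℝ) (hA : ∀ n, IsCauchyMatrix (P n) (A n))
    {z : ℂ} (hz : 0 < z.re) :
    Tendsto (fun n => ∫ ω, invSqrtDet (rescaledEigenvalue (A n ω)) z ∂(P n)) atTop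
      (𝓝 (Complex.exp (-(2 / (Real.pi : ℂ)) * z ^ (1 / 2 : ℂ)))) := by
  have hpi := Real.pi_pos
  have hpc : (Real.pi : ℂ) ≠ 0 := Complex.ofReal_ne_zero.mpr hpi.ne'
  have hmt : Tendsto m atTop atTop := tendsto_atTop_mono hm tendsto_id
  -- All Gaussian vectors are realised as initial segments of one iid sequence, so that the strong
  -- law applies almost surely.
  obtain ⟨Ω', _, μ, G, hGm, hGl, hGi, _⟩ := exists_iid ℕ (gaussianReal 0 1)
  have hζre : ∀ n (ω : Ω'), 0 ≤ (z * (((∑ k ∈ Finset.range n, |G k ω|) / n : ℝ) : ℂ) ^ 2 / 2).re := by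
    intro n ω
    rw [← Complex.ofReal_pow, show (2 : ℂ) = ((2 : ℝ) : ℂ) by norm_num, Complex.div_ofReal_re,
      Complex.re_mul_ofReal]
    positivity
  have hrep : ∀ n, ∫ ω, invSqrtDet (rescaledEigenvalue (A n ω)) z ∂(P n) =
      ∫ ω, cauchySqLaplace (z * (((∑ k ∈ Finset.range n, |G k ω|) / n : ℝ) : ℂ) ^ 2 / 2 /
        (m n : ℂ) ^ 2) ^ (m n) ∂μ := by
    intro n
    have hmap : μ.map (fun ω (k : Fin n) => G k ω) =
        Measure.pi fun _ : Fin n => gaussianReal 0 1 := by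
      rw [(iIndepFun_iff_map_fun_eq_pi_map fun k : Fin n => (hGm k).aemeasurable).mp
        (hGi.precomp Fin.val_injective)]
      simp_rw [fun k => (hGl k).map_eq]
    have hmeas : Measurable fun g : Fin n → ℝ =>
        cauchySqLaplace (z * (((∑ k, |g k|) / n : ℝ) : ℂ) ^ 2 / 2 / (m n : ℂ) ^ 2) ^ (m n) :=
      (measurable_cauchySqLaplace.comp (by fun_prop)).pow_const _
    rw [(hA n).integral_invSqrtDet hz, ← hmap, integral_map
      (measurable_pi_lambda _ fun k : Fin n => hGm k).aemeasurable hmeas.aestronglyMeasurable]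
    refine integral_congr_ae (ae_of_all _ fun ω => ?_)
    beta_reduce
    rw [Fin.sum_univ_eq_sum_range (fun k => |G k ω|) n]
  have hslln : ∀ᵐ ω ∂μ, Tendsto (fun n : ℕ => (∑ k ∈ Finset.range n, |G k ω|) / (n : ℝ)) atTop
      (𝓝 (2 / Real.sqrt (2 * Real.pi))) := by
    have hint : Integrable (fun x : ℝ => |x|) (gaussianReal 0 1) :=
      (IsGaussian.integrable_id (μ := gaussianReal 0 1)).abs
    have h := strong_law_ae_real (μ := μ) (fun k ω => |G k ω|)
      (((hGl 0).map_eq ▸ hint).comp_aemeasurable (hGl 0).aemeasurable)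
      (fun i j hij => (hGi.indepFun hij).comp measurable_abs measurable_abs)
      (fun i => ((hGl i).identDistrib (hGl 0)).comp measurable_abs)
    rwa [show ∫ ω, |G 0 ω| ∂μ = 2 / Real.sqrt (2 * Real.pi) from
      ((hGl 0).integral_comp (f := fun x : ℝ => |x|) (by fun_prop)).trans
        integral_abs_gaussianReal] at h
  simp_rw [hrep]
  have hlimval : ∫ _ : Ω', Complex.exp (-(2 / (Real.pi : ℂ)) * z ^ (1 / 2 : ℂ)) ∂μ =
      Complex.exp (-(2 / (Real.pi : ℂ)) * z ^ (1 / 2 : ℂ)) := by simp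
  rw [← hlimval]
  refine tendsto_integral_filter_of_dominated_convergence (fun _ => 1) ?_ ?_
    (integrable_const _) ?_
  · refine Eventually.of_forall fun n => Measurable.aestronglyMeasurable ?_
    exact Measurable.pow_const (measurable_cauchySqLaplace.comp (by fun_prop)) _
  · refine Eventually.of_forall fun n => ae_of_all _ fun ω => ?_
    rw [norm_pow]
    refine pow_le_one₀ (norm_nonneg _) (norm_cauchySqLaplace_le_one ?_)
    rw [show (m n : ℂ) ^ 2 = (((m n : ℝ) ^ 2 : ℝ) : ℂ) by push_cast; rfl, Complex.div_ofReal_re]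
    exact div_nonneg (hζre n ω) (by positivity)
  · filter_upwards [hslln] with ω hω
    -- `E|g| = 2/√(2π)` has square `2/π`; halving it gives the limit `ζ₀ = z/π`.
    have hsq : (2 / Real.sqrt (2 * Real.pi)) ^ 2 = 2 / Real.pi := by
      rw [div_pow, Real.sq_sqrt (by positivity)]; field_simp
    have hζ : Tendsto (fun n : ℕ => z * (((∑ k ∈ Finset.range n, |G k ω|) / n : ℝ) : ℂ) ^ 2 / 2)
        atTop (𝓝 (z / Real.pi)) := by
      have h1 := ((Complex.continuous_ofReal.tendsto _).comp (hω.pow 2))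
      rw [hsq] at h1
      have h2 := (h1.const_mul z).div_const 2
      have h3 : z * ((2 / Real.pi : ℝ) : ℂ) / 2 = z / Real.pi := by push_cast; field_simp
      rw [h3] at h2
      refine h2.congr fun n => ?_
      simp
    have hζ₀ : 0 < (z / Real.pi).re := by rw [Complex.div_ofReal_re]; positivity
    have h := tendsto_cauchySqLaplace_pow hmt (fun n => hζre n ω) hζ₀ hζ
    convert h using 3
    have hzs : z ∈ Complex.slitPlane := Or.inl hz
    have hz0 := Complex.slitPlane_ne_zero hzs
    -- The exponent simplifies by `(z/π) (π²/z)^(1/2) = √z`, with principal branches throughout.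
    have e1 : (Real.pi : ℂ) / (z / Real.pi) = ((Real.pi ^ 2 : ℝ) : ℂ) * z⁻¹ := by
      push_cast; field_simp
    have e2 : Complex.exp ((Real.log (Real.pi ^ 2) : ℂ) * (1 / 2)) = Real.pi := by
      rw [Real.log_pow]
      push_cast
      rw [show 2 * (Real.log Real.pi : ℂ) * (1 / 2) = (Real.log Real.pi : ℂ) by ring,
        ← Complex.ofReal_exp, Real.exp_log hpi]
    have e3 : z * Complex.exp (-(Complex.log z * (1 / 2))) = Complex.exp (Complex.log z * (1 / 2)) := by
      nth_rewrite 1 [← Complex.exp_log hz0]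
      rw [← Complex.exp_add]
      ring_nf
    rw [e1, Complex.cpow_def_of_ne_zero (mul_ne_zero (Complex.ofReal_ne_zero.mpr (by positivity))
      (inv_ne_zero hz0)), Complex.log_ofReal_mul (by positivity) (inv_ne_zero hz0),
      Complex.log_inv _ (Complex.slitPlane_arg_ne_pi hzs), add_mul, Complex.exp_add, e2,
      Complex.cpow_def_of_ne_zero hz0, ← e3, neg_mul]
    field_simp

/-! ### The theorem: differentiating the two expectations -/

theorem corollary1 {Ω : ℕ → Type*} [∀ n, MeasurableSpace (Ω n)]
    (P : ∀ n, Measure (Ω n)) [∀ n, IsProbabilityMeasure (P n)]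
    (m : ℕ → ℕ) (hm : ∀ n, n ≤ m n)
    (A : ∀ n, Ω n → Matrix (Fin (m n)) (Fin n) ℝ) (hA : ∀ n, IsCauchyMatrix (P n) (A n))
    (z : ℂ) (hz : 0 < z.re) :
    (∀ n, Integrable (fun ω =>
        (∏ i, (1 + z * (rescaledEigenvalue (A n ω) i : ℂ)) ^ (-(1 / 2) : ℂ)) *
          ∑ j, (rescaledEigenvalue (A n ω) j : ℂ) /
            (1 + z * (rescaledEigenvalue (A n ω) j : ℂ))) (P n)) ∧
    Tendsto (fun n => ∫ ω,
        (∏ i, (1 + z * (rescaledEigenvalue (A n ω) i : ℂ)) ^ (-(1 / 2) : ℂ)) *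
          ∑ j, (rescaledEigenvalue (A n ω) j : ℂ) /
            (1 + z * (rescaledEigenvalue (A n ω) j : ℂ)) ∂(P n)) atTop
      (𝓝 (2 / (Real.pi : ℂ) * z ^ (-(1 / 2) : ℂ) *
        Complex.exp (-(2 / (Real.pi : ℂ)) * z ^ (1 / 2 : ℂ)))) ∧
    ∀ (Ω' : Type*) [MeasurableSpace Ω'] (Q : Measure Ω') [IsProbabilityMeasure Q]
      (X : ℕ → Ω' → ℝ), IsPoissonPointProcess Q cauchyIntensity X →
      (∀ᵐ ω ∂Q, Multipliable (fun i => (1 + z * (X i ω : ℂ)) ^ (-(1 / 2) : ℂ)) ∧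
        Summable (fun j => (X j ω : ℂ) / (1 + z * (X j ω : ℂ)))) ∧
      Integrable (fun ω => (∏' i, (1 + z * (X i ω : ℂ)) ^ (-(1 / 2) : ℂ)) *
        ∑' j, (X j ω : ℂ) / (1 + z * (X j ω : ℂ))) Q ∧
      ∫ ω, (∏' i, (1 + z * (X i ω : ℂ)) ^ (-(1 / 2) : ℂ)) *
          ∑' j, (X j ω : ℂ) / (1 + z * (X j ω : ℂ)) ∂Q =
        2 / (Real.pi : ℂ) * z ^ (-(1 / 2) : ℂ) *
          Complex.exp (-(2 / (Real.pi : ℂ)) * z ^ (1 / 2 : ℂ))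
  := by 
  have hsum : ∀ n (ω : Ω n), Summable (rescaledEigenvalue (A n ω)) := fun _ _ => .of_finite
  have hnn : ∀ n (ω : Ω n) i, 0 ≤ rescaledEigenvalue (A n ω) i :=
    fun n ω => rescaledEigenvalue_nonneg (A n ω)
  have hdet : ∀ n (ω : Ω n),
      (∏ i, (1 + z * (rescaledEigenvalue (A n ω) i : ℂ)) ^ (-(1 / 2) : ℂ)) *
        ∑ j, (rescaledEigenvalue (A n ω) j : ℂ) / (1 + z * (rescaledEigenvalue (A n ω) j : ℂ)) =
      -2 * deriv (invSqrtDet (rescaledEigenvalue (A n ω))) z := fun n ω => by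
    rw [← deriv_invSqrtDet (hnn n ω) (hsum n ω) hz, tprod_fintype, tsum_fintype]
  have hmat : ∀ n, ∀ w : ℂ, 0 < w.re → _ := fun n w hw =>
    hasDerivAt_integral_of_bounded_holomorphic (P := P n)
      (F := fun w ω => invSqrtDet (rescaledEigenvalue (A n ω)) w)
      (fun w hw => (hA n).aestronglyMeasurable_invSqrtDet hw)
      (ae_of_all _ fun ω => differentiableOn_invSqrtDet (hnn n ω) (hsum n ω))
      (ae_of_all _ fun ω w hw => norm_invSqrtDet_le_one (hnn n ω) (hsum n ω) hw) (z := w) hw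
  have hlimit : ∀ w : ℂ, 0 < w.re → HasDerivAt
      (fun w : ℂ => Complex.exp (-(2 / (Real.pi : ℂ)) * w ^ (1 / 2 : ℂ)))
      (-(1 / 2) * (2 / (Real.pi : ℂ) * w ^ (-(1 / 2) : ℂ) *
        Complex.exp (-(2 / (Real.pi : ℂ)) * w ^ (1 / 2 : ℂ)))) w := by
    intro w hw
    have h1 := ((hasDerivAt_id w).cpow_const (c := 1 / 2) (Or.inl hw)).const_mul
      (-(2 / (Real.pi : ℂ)))
    refine h1.cexp.congr_deriv ?_
    rw [show (1 / 2 - 1 : ℂ) = -(1 / 2) by norm_num]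
    simp only [id]
    ring
  have hval : 2 / (Real.pi : ℂ) * z ^ (-(1 / 2) : ℂ) *
      Complex.exp (-(2 / (Real.pi : ℂ)) * z ^ (1 / 2 : ℂ)) =
      -2 * deriv (fun w : ℂ => Complex.exp (-(2 / (Real.pi : ℂ)) * w ^ (1 / 2 : ℂ))) z := by
    rw [(hlimit z hz).deriv]
    ring
  refine ⟨fun n => ?_, ?_, ?_⟩
  · simp_rw [hdet]
    exact (hmat n z hz).1.const_mul _
  · simp_rw [hdet, integral_const_mul]
    rw [hval]
    refine Tendsto.const_mul _ ?_
    -- Expectations of derivatives become derivatives of expectations, so the limit passes through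
    -- `tendsto_deriv_of_bounded_rightHalfPlane`.
    simp_rw [fun n => (hmat n z hz).2.deriv.symm]
    refine tendsto_deriv_of_bounded_rightHalfPlane (fun n w hw =>
      (hmat n w hw).2.differentiableAt.differentiableWithinAt) (fun n w hw => ?_)
      (fun w hw => (hlimit w hw).differentiableAt.differentiableWithinAt)
      (fun w hw => tendsto_integral_invSqrtDet P m hm A hA hw) hz
    refine (norm_integral_le_of_norm_le_const (C := 1) (ae_of_all _ fun ω =>
      norm_invSqrtDet_le_one (hnn n ω) (hsum n ω) hw)).trans (by simp)
  · intro Ω' _ Q _ X hX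
    have hpos : ∀ ω i, 0 ≤ X i ω := fun ω i => (hX.pos i ω).le
    have hX' := hasDerivAt_integral_of_bounded_holomorphic (P := Q)
      (F := fun w ω => invSqrtDet (fun i => X i ω) w)
      (fun w hw => aestronglyMeasurable_invSqrtDet hX.measurable (fun i ω => hpos ω i)
        hX.ae_summable hw)
      (by filter_upwards [hX.ae_summable] with ω hω using
        differentiableOn_invSqrtDet (hpos ω) hω)
      (by filter_upwards [hX.ae_summable] with ω hω w hw using
        norm_invSqrtDet_le_one (hpos ω) hω hw) hz
    have hae : (fun ω => (∏' i, (1 + z * (X i ω : ℂ)) ^ (-(1 / 2) : ℂ)) *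
        ∑' j, (X j ω : ℂ) / (1 + z * (X j ω : ℂ))) =ᵐ[Q]
        fun ω => -2 * deriv (fun w => invSqrtDet (fun i => X i ω) w) z := by
      filter_upwards [hX.ae_summable] with ω hω
      exact deriv_invSqrtDet (hpos ω) hω hz
    refine ⟨?_, (hX'.1.const_mul _).congr hae.symm, ?_⟩
    · filter_upwards [hX.ae_summable] with ω hω
      exact ⟨(hasProd_invSqrtDet (hpos ω) hω hz).multipliable,
        Summable.of_norm_bounded hω fun i => norm_div_one_add_mul_le (hpos ω) hz i⟩
    · rw [integral_congr_ae hae, integral_const_mul, hval, ← hX'.2.deriv]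
      congr 1
      -- The Laplace functional is known only on the half-plane, which is a neighbourhood of `z`;
      -- that determines the derivative.
      refine Filter.EventuallyEq.deriv_eq ?_
      filter_upwards [isOpen_rightHalfPlane.mem_nhds hz] with w hw
      exact hX.integral_invSqrtDet hw
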